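/- Let $Q$ be a finite quiver with vertex set $\{1,\dots,n\}$, without loops or oriented 2-cycles (multiple arrows are allowed), and let $\mathcal{A}_Q\subset\mathbb{Q}(x_1,\dots,x_n)$ be its cluster algebra: the $\mathbb{Z}$-algebra generated by all cluster variables in all seeds obtained from the initial seed $(Q,(x_1,\dots,x_n))$ by repeated mutation. By the Laurent phenomenon, $\mathcal{A}_Q\subseteq\mathbb{Z}[x_1^{\pm1},\dots,x_n^{\pm1}]$. Specialisation relations $\sigma$ are relations $x_i=a_i$ with $a_i\in\{1,-1\}$ for the indices $i$ in some subset of $\{1,\dots,n\}$; the specialised cluster algebra $\mathcal{A}_Q|_\sigma$ is the image of $\mathcal{A}_Q$ under the substitution $\sigma$ in Laurent polynomials, and the initial cluster variables $x_{j_1},\dots,x_{j_\ell}$ to which $\sigma$ assigns no value are called the variables of $\mathcal{A}_Q|_\sigma$. The algebra $\mathcal{A}_Q|_\sigma$ is called polyamorous if, for each of its variables $x_j$, all its elements are polynomial in $x_j$ (that is, they are Laurent polynomials in the variables $x_{j_1},\dots,x_{j_\ell}$ in which $x_j$ has no negative exponents). Suppose that there are vertices $j,k$ of $Q$ such that the number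 of arrows between $j$ and $k$ is odd. Then: 1. there exist specialisation relations $\sigma$ such that $\mathcal{A}_Q|_\sigma$ is polyamorous and its set of variables $\{x_{j_1},\dots,x_{j_\ell}\}$ is nonempty; 2. for every $\sigma$ such that $\mathcal{A}_Q|_\sigma$ is polyamorous (in particular for those in 1), $\mathcal{A}_Q|_\sigma=\mathbb{Z}[x_{j_1},\dots,x_{j_\ell}]$. Here the inclusion $\mathcal{A}_Q\subseteq\mathbb{Z}[x_1^{\pm1},\dots,x_n^{\pm1}]$, by which the specialisation is defined on all of $\mathcal{A}_Q$, is understood as part of the assertion. -/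

import Mathlib

noncomputable section

namespace Cluster

/-- A finite quiver on the vertices `Fin n` without loops or oriented 2-cycles, given by its numbers
of arrows: `arrows i j` is the number of arrows `i → j` (multiple arrows are allowed). -/
@[ext]
structure ClusterQuiver (n : ℕ) where
  arrows : Fin n → Fin n → ℕ
  no_loops : ∀ i, arrows i i = 0
  no_two_cycles : ∀ i j, arrows i j = 0 ∨ arrows j i = 0

variable {n : ℕ}

namespace ClusterQuiver

/-- Mutation of a quiver at the vertex `k`: the arrows at `k` change direction, every directed
2-path through `k` is completed to a triangle, then oriented 2-cycles are removed. Completing the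
2-paths `i → k → j` adds an arrow `i → j` for each such path, because the reversed path is
`j → k → i`; the truncated subtraction of natural numbers removes the 2-cycles between `i`
and `j`. -/
def mutate (Q : ClusterQuiver n) (k : Fin n) : ClusterQuiver n where
  arrows i j :=
    if i = k ∨ j = k then Q.arrows j i
    else (Q.arrows i j + Q.arrows i k * Q.arrows k j) -
      (Q.arrows j i + Q.arrows j k * Q.arrows k i)
  no_loops i := by
    have h := Q.no_loops i
    split_ifs <;> simp [h]
  no_two_cycles i j := by
    have h := Q.no_two_cycles j i
    by_cases hk : i = k ∨ j = k
    · simpa [hk, hk.symm] using h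
    · have hk' : ¬(j = k ∨ i = k) := fun h' => hk h'.symm
      simp only [hk, hk', if_false]
      omega

/-- The number of arrows between two vertices, in either direction. -/
def arrowsBetween (Q : ClusterQuiver n) (i j : Fin n) : ℕ := Q.arrows i j + Q.arrows j i

end ClusterQuiver

/-- The field of rational functions `ℚ(x₁, …, xₙ)`, as the field of fractions of
`ℤ[x₁, …, xₙ]`. -/
abbrev AmbientField (n : ℕ) : Type := FractionRing (MvPolynomial (Fin n) ℤ)

/-- The initial cluster variable `xᵢ`. -/
def x (i : Fin n) : AmbientField n :=
  algebraMap (MvPolynomial (Fin n) ℤ) (AmbientField n) (MvPolynomial.X i)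

theorem x_ne_zero (i : Fin n) : (x i : AmbientField n) ≠ 0 := by
  simp [x, MvPolynomial.X_ne_zero]

/-- A cluster together with the corresponding quiver. -/
structure Seed (n : ℕ) where
  quiver : ClusterQuiver n
  cluster : Fin n → AmbientField n

/-- Mutation of a seed at the vertex `k`: the quiver is mutated at `k`, and the `k`-th cluster
variable is replaced according to the exchange relation. -/
def Seed.mutate (s : Seed n) (k : Fin n) : Seed n where
  quiver := s.quiver.mutate k
  cluster := Function.update s.cluster k
    ((∏ i, s.cluster i ^ s.quiver.arrows i k + ∏ i, s.cluster i ^ s.quiver.arrows k i) /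
      s.cluster k)

/-- The initial seed of a quiver. -/
def initialSeed (Q : ClusterQuiver n) : Seed n := ⟨Q, x⟩

/-- The seeds obtained from the initial seed by repeated mutation. -/
inductive IsSeedOf (Q : ClusterQuiver n) : Seed n → Prop
  | initial : IsSeedOf Q (initialSeed Q)
  | mutate (s : Seed n) (k : Fin n) : IsSeedOf Q s → IsSeedOf Q (s.mutate k)

/-- All cluster variables from all clusters. -/
def clusterVariables (Q : ClusterQuiver n) : Set (AmbientField n) :=
  {y | ∃ s, IsSeedOf Q s ∧ ∃ i, y = s.cluster i}

/-- The cluster algebra `𝒜_Q`. -/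
def clusterAlgebra (Q : ClusterQuiver n) : Subalgebra ℤ (AmbientField n) :=
  Algebra.adjoin ℤ (clusterVariables Q)

/-- The ring of integer Laurent polynomials in `n` indeterminates; exponent vectors are functions
`Fin n → ℤ`. -/
abbrev Laurent (n : ℕ) : Type := AddMonoidAlgebra ℤ (Fin n → ℤ)

/-- Evaluation of Laurent polynomials at invertible elements `u₁, …, uₙ`: the monomial with
exponent vector `m` is sent to `∏ uᵢ ^ mᵢ`. -/
def laurentEval (u : Fin n → (AmbientField n)ˣ) : Laurent n →ₐ[ℤ] AmbientField n :=
  AddMonoidAlgebra.lift ℤ (AmbientField n) (Fin n → ℤ)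
    { toFun := fun m => ((∏ i, u i ^ (m.toAdd i) : (AmbientField n)ˣ) : AmbientField n)
      map_one' := by simp
      map_mul' := fun a b => by simp [zpow_add, Finset.prod_mul_distrib] }

/-- The initial cluster variable `xᵢ` as an invertible element. -/
def xUnit (i : Fin n) : (AmbientField n)ˣ := Units.mk0 (x i) (x_ne_zero i)

/-- The ring `ℤ[x₁, …, xₙ, x₁⁻¹, …, xₙ⁻¹]` inside `ℚ(x₁, …, xₙ)`. -/
def laurentSubalgebra (n : ℕ) : Subalgebra ℤ (AmbientField n) := (laurentEval xUnit).range

/-- Specialisation relations, i.e. a partial labelling of the vertices by `±1`: `σ i = some a`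
stands for the relation `xᵢ = a`, and `σ i = none` says that `xᵢ` is not specialised. -/
abbrev Specialisation (n : ℕ) : Type := Fin n → Option ℤˣ

namespace Specialisation

/-- The indices of the variables that are not specialised. -/
def freeVariables (σ : Specialisation n) : Set (Fin n) := {i | σ i = none}

/-- The value to which `xᵢ` is specialised: `1` or `-1` if `i` is labelled, `xᵢ` itself if not. -/
def value (σ : Specialisation n) (i : Fin n) : (AmbientField n)ˣ :=
  match σ i with
  | none => xUnit i
  | some a => Units.map (algebraMap ℤ (AmbientField n)).toMonoidHom a

end Specialisation

/-- The specialised cluster algebra `𝒜_Q|_σ`: every element of `𝒜_Q` is written as a Laurent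
polynomial in the initial cluster variables, in which the labelled variables are then replaced
by their labels. -/
def specialisedClusterAlgebra (Q : ClusterQuiver n) (σ : Specialisation n) :
    Subalgebra ℤ (AmbientField n) :=
  ((clusterAlgebra Q).comap (laurentEval xUnit)).map (laurentEval σ.value)

/-- The elements that are polynomial in `xⱼ` and Laurent polynomial in the other variables
that `σ` does not specialise. -/
def polynomialIn (σ : Specialisation n) (j : Fin n) : Subalgebra ℤ (AmbientField n) :=
  Algebra.adjoin ℤ ({x j} ∪ {y | ∃ i ∈ σ.freeVariables, i ≠ j ∧ (y = x i ∨ y = (x i)⁻¹)})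

/-- The variable `xⱼ` of `𝒜_Q|_σ` is polyamorous: all elements of `𝒜_Q|_σ` are polynomial
in it. -/
def IsPolyamorousVariable (Q : ClusterQuiver n) (σ : Specialisation n) (j : Fin n) : Prop :=
  j ∈ σ.freeVariables ∧ ∀ z ∈ specialisedClusterAlgebra Q σ, z ∈ polynomialIn σ j

/-- `𝒜_Q|_σ` is polyamorous: all variables in it are. -/
def IsPolyamorous (Q : ClusterQuiver n) (σ : Specialisation n) : Prop :=
  ∀ j ∈ σ.freeVariables, IsPolyamorousVariable Q σ j

/-- The polynomial ring `ℤ[x_{j₁}, …, x_{jₗ}]` in the variables that `σ` does not specialise,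
inside `ℚ(x₁, …, xₙ)`. -/
def polynomialRing (σ : Specialisation n) : Subalgebra ℤ (AmbientField n) :=
  Algebra.adjoin ℤ (x '' σ.freeVariables)

end Cluster

end

noncomputable section

namespace Cluster

/-! The Laurent phenomenon applies with any seed as the starting point, so an element z of the
cluster algebra is a Laurent polynomial both in the initial cluster and in the cluster mutated at j.
The second cluster has x_j' = M r / x_j in place of x_j, where M is a monomial and r = 1 + ∏ x_i ^
B_ij, neither of them involving x_j. Terms of z with a positive power of x_j' are multiples of r;
the others carry nonnegative powers of x_j, over a power of r. Hence z is congruent modulo r to an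
element polynomial in x_j (`exists_dvd_sub_of_mem_adjacentLaurent`). If σ leaves x_j free and sends
r to 0, then x_j is polyamorous (`isPolyamorousVariable_of_exchange`). To achieve this, keep only
x_j free, put x_k = -1 and all other variables equal to 1: since B_kj is odd, r becomes 1 + (-1) =
0. The second assertion is formal. A Laurent expression is unique, so being polynomial in each free
variable separately means being polynomial in all of them; conversely the initial variables lie in
the cluster algebra.

The Laurent phenomenon itself (`isLaurent_run`) is proved by induction on the number of mutations.
Cluster variables are treated as functions on positive real points, where the exchange recursion
never divides by zero and Laurent polynomials are determined by their values. For a path starting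
with j, k, the induction hypothesis gives Laurent expressions in the clusters reached by j and by j,
k, j. Expanded in the initial cluster, the first has only powers of r as denominator up to units.
The prime r divides no variable of the second cluster, so the denominator cancels
(`isLaurent_of_mutations`). Primality of r is forced by an auxiliary vertex joined to j only, whose
variable is set to 1 at the end. -/

/-! ### Laurent polynomials and their evaluations -/

/-- Integer Laurent polynomials in variables indexed by `V`. -/
abbrev LaurentRing (V : Type*) : Type _ := AddMonoidAlgebra ℤ (V → ℤ)

/-- The multiplicative group of positive real numbers. -/
abbrev PosReal : Type := {r : ℝ // 0 < r}

section Monomial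

variable {V G A : Type*} [Fintype V] [CommGroup G] [CommRing A] [Algebra ℤ A]

/-- The Laurent monomial `∏ uᵢ ^ mᵢ` as a function of `m`. -/
def monomialHom (u : V → G) : Multiplicative (V → ℤ) →* G where
  toFun m := ∏ i, u i ^ (m.toAdd i)
  map_one' := by simp
  map_mul' a b := by simp [zpow_add, Finset.prod_mul_distrib]

/-- The Laurent monomial `∏ uᵢ ^ mᵢ`. -/
def monomial (u : V → G) (m : V → ℤ) : G := ∏ i, u i ^ m i

theorem monomial_add (u : V → G) (m m' : V → ℤ) :
    monomial u (m + m') = monomial u m * monomial u m' := by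
  simp [monomial, zpow_add, Finset.prod_mul_distrib]

theorem monomial_neg (u : V → G) (m : V → ℤ) : monomial u (-m) = (monomial u m)⁻¹ := by
  simp [monomial]

theorem monomial_sub (u : V → G) (m m' : V → ℤ) :
    monomial u (m - m') = monomial u m / monomial u m' := by
  rw [sub_eq_add_neg, monomial_add, monomial_neg, div_eq_mul_inv]

theorem monomial_zsmul (u : V → G) (c : ℤ) (m : V → ℤ) :
    monomial u (c • m) = monomial u m ^ c := by
  simp [monomial, mul_comm c, zpow_mul, Finset.prod_zpow]

theorem monomial_single [DecidableEq V] (u : V → G) (i : V) (c : ℤ) :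
    monomial u (Pi.single i c) = u i ^ c := by
  rw [monomial, Finset.prod_eq_single i]
  · simp
  · intro j _ h
    simp [h]
  · simp

theorem monomial_update [DecidableEq V] (u : V → G) (k : V) (a : G) (m : V → ℤ) :
    monomial (Function.update u k a) m = (a / u k) ^ m k * monomial u m := by
  have h : ∀ v : V → G, monomial v m = v k ^ m k * ∏ i ∈ Finset.univ.erase k, v i ^ m i :=
    fun v => (Finset.mul_prod_erase _ _ (Finset.mem_univ k)).symm
  rw [h, h u, div_zpow, Function.update_self, ← mul_assoc, div_mul_cancel]
  congr 1
  refine Finset.prod_congr rfl fun i hi => ?_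
  rw [Function.update_of_ne (Finset.ne_of_mem_erase hi)]

/-- Evaluation of Laurent polynomials at elements of a group mapping to a commutative ring. -/
def evalHom (ι : G →* A) (u : V → G) : LaurentRing V →ₐ[ℤ] A :=
  AddMonoidAlgebra.lift ℤ A (V → ℤ) (ι.comp (monomialHom u))

/-- The Laurent monomial with a given exponent vector. -/
def laurentMonomial (m : V → ℤ) : LaurentRing V := AddMonoidAlgebra.single m 1

omit [Fintype V] in
theorem laurentMonomial_add (m m' : V → ℤ) :
    laurentMonomial (m + m') = laurentMonomial m * laurentMonomial m' := by
  simp [laurentMonomial, AddMonoidAlgebra.single_mul_single]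

omit [Fintype V] in
theorem laurentMonomial_zero : laurentMonomial (0 : V → ℤ) = 1 := rfl

omit [Fintype V] in
theorem laurentMonomial_mul_neg (m : V → ℤ) :
    laurentMonomial m * laurentMonomial (-m) = 1 := by
  rw [← laurentMonomial_add, add_neg_cancel, laurentMonomial_zero]

omit [Fintype V] in
theorem isUnit_laurentMonomial (m : V → ℤ) : IsUnit (laurentMonomial m) :=
  IsUnit.of_mul_eq_one _ (laurentMonomial_mul_neg m)

/-- The Laurent monomials as a homomorphism to the group of units. -/
def laurentMonomialUnit : Multiplicative (V → ℤ) →* (LaurentRing V)ˣ :=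
  MonoidHom.toHomUnits
    { toFun := fun m => laurentMonomial m.toAdd
      map_one' := rfl
      map_mul' := fun a b => laurentMonomial_add a.toAdd b.toAdd }

omit [Fintype V] in
theorem coe_laurentMonomialUnit (m : V → ℤ) :
    (laurentMonomialUnit (Multiplicative.ofAdd m) : LaurentRing V) = laurentMonomial m := rfl

omit [Fintype V] in
theorem single_eq_smul_laurentMonomial (m : V → ℤ) (c : ℤ) :
    (AddMonoidAlgebra.single m c : LaurentRing V) = c • laurentMonomial m := by
  simp [laurentMonomial]

omit [Fintype V] in
theorem laurent_induction {motive : LaurentRing V → Prop} (z : LaurentRing V)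
    (zero : motive 0) (add : ∀ a b, motive a → motive b → motive (a + b))
    (smul_monomial : ∀ (c : ℤ) m, motive (c • laurentMonomial m)) : motive z := by
  induction z using AddMonoidAlgebra.induction_linear with
  | zero => exact zero
  | add a b ha hb => exact add a b ha hb
  | single m c => rw [single_eq_smul_laurentMonomial]; exact smul_monomial c m

@[simp]
theorem evalHom_laurentMonomial (ι : G →* A) (u : V → G) (m : V → ℤ) :
    evalHom ι u (laurentMonomial m) = ι (monomial u m) := by
  rw [evalHom, laurentMonomial, AddMonoidAlgebra.lift_single]
  rw [Algebra.smul_def, map_one, one_mul]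
  rfl

omit [Fintype V] in
theorem laurent_algHom_ext {φ ψ : LaurentRing V →ₐ[ℤ] A}
    (h : ∀ m, φ (laurentMonomial m) = ψ (laurentMonomial m)) : φ = ψ := by
  ext z
  exact h _

theorem laurentEval_eq_evalHom {n : ℕ} (u : Fin n → (AmbientField n)ˣ) :
    laurentEval u = evalHom (Units.coeHom _) u := rfl

end Monomial

/-! ### Evaluation at positive real points -/

section Positive

variable {V : Type*} [Fintype V]

/-- The inclusion of the positive real numbers into the real numbers. -/
def posRealHom : PosReal →* ℝ where
  toFun := Subtype.val
  map_one' := rfl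
  map_mul' _ _ := rfl

theorem posRealHom_ne_zero (a : PosReal) : posRealHom a ≠ 0 := a.2.ne'

theorem posRealHom_add (a b : PosReal) : posRealHom (a + b) = posRealHom a + posRealHom b := rfl

/-- The value of a Laurent polynomial at a positive real point. -/
def posEval (u : V → PosReal) : LaurentRing V →ₐ[ℤ] ℝ := evalHom posRealHom u

@[simp]
theorem posEval_laurentMonomial (u : V → PosReal) (m : V → ℤ) :
    posEval u (laurentMonomial m) = posRealHom (monomial u m) :=
  evalHom_laurentMonomial _ _ _

/-- Laurent polynomials are determined by their values at positive real points. -/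
theorem laurent_ext_posEval {z w : LaurentRing V} (h : ∀ u, posEval u z = posEval u w) :
    z = w := by
  classical
  rw [← sub_eq_zero]
  have h0 : ∀ u, posEval u (z - w) = 0 := fun u => by rw [map_sub, h, sub_self]
  generalize z - w = y at h0
  -- Monomials are characters of the group of positive points. Distinct exponent vectors give
  -- distinct characters, as the points with one coordinate 2 and the rest 1 show, and distinct
  -- characters are linearly independent (Dedekind).
  let χ (m : V → ℤ) : (V → PosReal) →* ℝ :=
    { toFun := fun u => posRealHom (monomial u m)
      map_one' := by simp [monomial]
      map_mul' := fun a b => by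
        rw [← map_mul]
        congr 1
        simp [monomial, mul_zpow, Finset.prod_mul_distrib] }
  have hχ : Function.Injective χ := by
    intro m m' hm
    funext i
    have h1 := DFunLike.congr_fun hm (Pi.mulSingle i ⟨2, two_pos⟩)
    have h2 : ∀ m : V → ℤ, χ m (Pi.mulSingle i ⟨2, two_pos⟩) = 2 ^ m i := by
      intro m
      change posRealHom (monomial _ m) = _
      rw [monomial, Finset.prod_eq_single i]
      · rw [Pi.mulSingle_eq_same]
        exact Positive.coe_zpow _ _
      · intro j _ hj
        rw [Pi.mulSingle_eq_of_ne hj, one_zpow]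
      · simp
    rw [h2, h2] at h1
    exact zpow_right_injective₀ two_pos (by norm_num) h1
  have hli := (linearIndependent_monoidHom (V → PosReal) ℝ).comp χ hχ
  rw [linearIndependent_iff'] at hli
  have hy : y = ∑ m ∈ y.coeff.support, y.coeff m • laurentMonomial m := by
    apply AddMonoidAlgebra.ext
    ext m
    simp [laurentMonomial, Finsupp.single_apply]
  have hs := hli y.coeff.support (fun m => (y.coeff m : ℝ)) (by
    funext u
    have := h0 u
    rw [hy, map_sum] at this
    simpa [Finset.sum_apply, χ] using this)
  rw [hy]
  refine Finset.sum_eq_zero fun m hm => ?_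
  have := hs m hm
  rw [Int.cast_eq_zero] at this
  rw [this, zero_smul]

end Positive

/-! ### Mutation of exchange matrices and of positive real points -/

section Mutation

variable {V : Type*} [DecidableEq V]

/-- Mutation of an exchange matrix. -/
def mutateMatrix (B : V → V → ℤ) (k : V) : V → V → ℤ := fun i j =>
  if i = k ∨ j = k then -B i j
  else B i j + (max (B i k) 0 * max (B k j) 0 - max (-B i k) 0 * max (-B k j) 0)

theorem mutateMatrix_left (B : V → V → ℤ) (k j : V) : mutateMatrix B k k j = -B k j := by
  simp [mutateMatrix]

theorem mutateMatrix_right (B : V → V → ℤ) (k i : V) : mutateMatrix B k i k = -B i k := by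
  simp [mutateMatrix]

theorem mutateMatrix_of_ne (B : V → V → ℤ) {k i j : V} (hi : i ≠ k) (hj : j ≠ k) :
    mutateMatrix B k i j =
      B i j + (max (B i k) 0 * max (B k j) 0 - max (-B i k) 0 * max (-B k j) 0) := by
  simp [mutateMatrix, hi, hj]

theorem mutateMatrix_skew {B : V → V → ℤ} (hB : ∀ i j, B j i = -B i j) (k i j : V) :
    mutateMatrix B k j i = -mutateMatrix B k i j := by
  by_cases hi : i = k
  · subst hi
    rw [mutateMatrix_left, mutateMatrix_right, hB]
  by_cases hj : j = k
  · subst hj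
    rw [mutateMatrix_left, mutateMatrix_right, hB]
  rw [mutateMatrix_of_ne B hi hj, mutateMatrix_of_ne B hj hi, hB i j, hB k j, hB i k, neg_neg,
    neg_neg]
  ring

theorem mutateMatrix_mutateMatrix (B : V → V → ℤ) (k : V) :
    mutateMatrix (mutateMatrix B k) k = B := by
  funext i j
  by_cases hi : i = k
  · subst hi
    simp [mutateMatrix_left]
  by_cases hj : j = k
  · subst hj
    simp [mutateMatrix_right]
  rw [mutateMatrix_of_ne _ hi hj, mutateMatrix_of_ne _ hi hj, mutateMatrix_left,
    mutateMatrix_right, neg_neg, neg_neg]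
  ring

theorem mutateMatrix_neg (B : V → V → ℤ) (k : V) : mutateMatrix (-B) k = -mutateMatrix B k := by
  funext i j
  by_cases hij : i = k ∨ j = k
  · simp [mutateMatrix, hij]
  · simp only [mutateMatrix, hij, if_false, Pi.neg_apply, neg_neg]
    ring

omit [DecidableEq V] in
theorem skew_self {B : V → V → ℤ} (hB : ∀ i j, B j i = -B i j) (i : V) : B i i = 0 := by
  have := hB i i
  omega

variable [Fintype V]

/-- The right hand side of the exchange relation at `k`. -/
def exchange (B : V → V → ℤ) (u : V → PosReal) (k : V) : PosReal :=
  monomial u (fun i => max (B i k) 0) + monomial u (fun i => max (-B i k) 0)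

/-- Mutation of a positive real point at `k`. -/
def mutateVars (B : V → V → ℤ) (k : V) (u : V → PosReal) : V → PosReal :=
  Function.update u k (exchange B u k / u k)

omit [DecidableEq V] in
-- Since [b]₊ = [-b]₊ + b, a monomial splits off and the binomial 1 + x ^ B_k remains; this is the
-- factor whose primality and vanishing matter.
theorem exchange_eq (B : V → V → ℤ) (u : V → PosReal) (k : V) :
    exchange B u k =
      monomial u (fun i => max (-B i k) 0) * (1 + monomial u (fun i => B i k)) := by
  have h : (fun i => max (B i k) 0) = (fun i => max (-B i k) 0) + fun i => B i k := by
    funext i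
    simp only [Pi.add_apply]
    omega
  rw [exchange, h, monomial_add, mul_add, mul_one, add_comm]

theorem mutateVars_self (B : V → V → ℤ) (k : V) (u : V → PosReal) :
    mutateVars B k u k = exchange B u k / u k := Function.update_self ..

theorem mutateVars_of_ne (B : V → V → ℤ) {k i : V} (u : V → PosReal) (h : i ≠ k) :
    mutateVars B k u i = u i := Function.update_of_ne h ..

theorem monomial_update_of_eq_zero (u : V → PosReal) (k : V) (a : PosReal) {m : V → ℤ}
    (h : m k = 0) : monomial (Function.update u k a) m = monomial u m := by
  rw [monomial_update, h, zpow_zero, one_mul]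

theorem mutateVars_mutateVars {B : V → V → ℤ} {k : V} (hB : B k k = 0) (u : V → PosReal) :
    mutateVars (mutateMatrix B k) k (mutateVars B k u) = u := by
  have h : exchange (mutateMatrix B k) (mutateVars B k u) k = exchange B u k := by
    simp only [exchange, mutateMatrix_right, neg_neg, mutateVars]
    rw [monomial_update_of_eq_zero _ _ _ (by simp [hB]),
      monomial_update_of_eq_zero _ _ _ (by simp [hB]), add_comm]
  funext i
  by_cases hi : i = k
  · subst hi
    rw [mutateVars_self, h, mutateVars_self, div_div_cancel]
  · rw [mutateVars_of_ne _ _ hi, mutateVars_of_ne _ _ hi]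

omit [DecidableEq V] in
theorem exchange_neg (B : V → V → ℤ) (u : V → PosReal) (k : V) :
    exchange (-B) u k = exchange B u k := by
  simp only [exchange, Pi.neg_apply, neg_neg]
  rw [add_comm]

theorem mutateVars_neg (B : V → V → ℤ) (k : V) (u : V → PosReal) :
    mutateVars (-B) k u = mutateVars B k u := by
  rw [mutateVars, exchange_neg, mutateVars]

/-- The mutation rule for the `y`-variable at the mutated vertex. -/
theorem monomial_mutate_self {B : V → V → ℤ} {k : V} (hB : B k k = 0) (u : V → PosReal) :
    monomial (mutateVars B k u) (fun i => mutateMatrix B k i k) =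
      (monomial u fun i => B i k)⁻¹ := by
  simp only [mutateMatrix_right]
  rw [mutateVars, monomial_update_of_eq_zero _ _ _ (by simp [hB]), ← monomial_neg]
  rfl

/-- The mutation rule for the `y`-variables at the other vertices. -/
theorem monomial_mutate_of_ne {B : V → V → ℤ} {k j : V} (hB : B k k = 0) (hj : j ≠ k)
    (h : B k j ≤ 0) (u : V → PosReal) :
    monomial (mutateVars B k u) (fun i => mutateMatrix B k i j) =
      (monomial u fun i => B i j) * (1 + monomial u fun i => B i k) ^ (-B k j) := by
  -- With c = -B k j ≥ 0, the mutated column is B_ij - c [-B_ik]₊ away from k, and at k it is B_kj +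
  -- 2c. The last two summands cancel the monomial part of the exchange relation and the two factors
  -- u k in the denominator.
  have hm : (fun i => mutateMatrix B k i j) = (fun i => B i j) +
      (-(-B k j) • (fun i => max (-B i k) 0) + Pi.single k (2 * -B k j)) := by
    funext i
    by_cases hi : i = k
    · subst hi
      simp [mutateMatrix_left, hB]
      ring
    · have h1 : max (-B k j) 0 = -B k j := by omega
      have h2 : max (B k j) 0 = 0 := by omega
      simp [mutateMatrix_of_ne B hi hj, hi, h1, h2]
      ring
  have hk : mutateMatrix B k k j = -B k j := mutateMatrix_left B k j
  rw [mutateVars, monomial_update, hk, hm]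
  generalize -B k j = c
  rw [monomial_add, monomial_add, monomial_single, monomial_zsmul, exchange_eq, zpow_mul,
    zpow_two, div_div, div_zpow, mul_zpow, zpow_neg, div_eq_mul_inv]
  generalize (monomial u fun i => max (-B i k) 0) ^ c = a
  generalize (1 + monomial u fun i => B i k) ^ c = b
  generalize (u k * u k) ^ c = d
  generalize (monomial u fun i => B i j) = e
  calc a * b * d⁻¹ * (e * (a⁻¹ * d)) = (a * a⁻¹) * (d⁻¹ * d) * (e * b) := by ac_rfl
    _ = e * b := by simp

/-- The point that is reached from a point by a sequence of mutations. -/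
def run : List V → (V → V → ℤ) → (V → PosReal) → V → PosReal
  | [], _, u => u
  | k :: ks, B, u => run ks (mutateMatrix B k) (mutateVars B k u)

omit [Fintype V] in
/-- The exchange matrix that is reached by a sequence of mutations. -/
def runMatrix (ks : List V) (B : V → V → ℤ) : V → V → ℤ := ks.foldl mutateMatrix B

theorem run_neg (ks : List V) (B : V → V → ℤ) (u : V → PosReal) : run ks (-B) u = run ks B u := by
  induction ks generalizing B u with
  | nil => rfl
  | cons k ks ih => rw [run, run, mutateMatrix_neg, mutateVars_neg, ih]

omit [Fintype V] in
theorem runMatrix_concat (ks : List V) (k : V) (B : V → V → ℤ) :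
    runMatrix (ks ++ [k]) B = mutateMatrix (runMatrix ks B) k := by
  rw [runMatrix, List.foldl_concat, runMatrix]

theorem run_concat (ks : List V) (k : V) (B : V → V → ℤ) (u : V → PosReal) :
    run (ks ++ [k]) B u = mutateVars (runMatrix ks B) k (run ks B u) := by
  induction ks generalizing B u with
  | nil => rfl
  | cons k ks ih => exact ih _ _

/-- Mutation is an involution, so a path from one seed can also be read as a path from any
neighbouring seed. This is what lets the starting cluster vary. -/
theorem run_cancel {B : V → V → ℤ} {k : V} (hB : B k k = 0) (ks : List V) (u : V → PosReal) :
    run (k :: ks) (mutateMatrix B k) (mutateVars B k u) = run ks B u := by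
  rw [run, mutateMatrix_mutateMatrix, mutateVars_mutateVars hB]

/-- Adding a vertex at which all variables are `1` does not change mutations at the others. -/
theorem run_map_some {B : V → V → ℤ} {B' : Option V → Option V → ℤ} {u : V → PosReal}
    {u' : Option V → PosReal} (hB : ∀ i j, B' (some i) (some j) = B i j)
    (hu : ∀ i, u' (some i) = u i) (hu' : u' none = 1) (ks : List V) (i : V) :
    run (ks.map some) B' u' (some i) = run ks B u i := by
  induction ks generalizing B B' u u' with
  | nil => exact hu i
  | cons k ks ih =>
    refine ih ?_ ?_ ?_
    · intro i j
      simp [mutateMatrix, hB]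
    · intro i
      have he : exchange B' u' (some k) = exchange B u k := by
        simp [exchange, monomial, Fintype.prod_option, hB, hu, hu']
      by_cases hi : i = k
      · subst hi
        rw [mutateVars_self, mutateVars_self, he, hu]
      · rw [mutateVars_of_ne _ _ hi, mutateVars_of_ne _ _ (by simpa using hi), hu]
    · rw [mutateVars_of_ne _ _ (by simp), hu']

end Mutation

/-! ### Primality of exchange binomials -/

section Prime

variable {V : Type*}

/-- The endomorphism of the Laurent ring that eliminates the variable `f` by means of the
relation `1 + x ^ β = 0`, where `β f = 1`. -/
def eliminate (f : V) (β : V → ℤ) : LaurentRing V →ₐ[ℤ] LaurentRing V :=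
  AddMonoidAlgebra.lift ℤ _ _ ((Units.coeHom _).comp
    { toFun := fun m => (-1 : (LaurentRing V)ˣ) ^ (m.toAdd f) *
        laurentMonomialUnit (Multiplicative.ofAdd (m.toAdd - m.toAdd f • β))
      map_one' := by simp
      map_mul' := fun a b => by
        have h : (a * b).toAdd - (a * b).toAdd f • β =
            (a.toAdd - a.toAdd f • β) + (b.toAdd - b.toAdd f • β) := by
          rw [toAdd_mul, Pi.add_apply, add_smul]
          abel
        rw [h, toAdd_mul, Pi.add_apply, zpow_add, ofAdd_add, map_mul laurentMonomialUnit]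
        exact mul_mul_mul_comm _ _ _ _ })

theorem eliminate_laurentMonomial (f : V) (β m : V → ℤ) :
    eliminate f β (laurentMonomial m) =
      (((-1 : (LaurentRing V)ˣ) ^ (m f) : (LaurentRing V)ˣ) : LaurentRing V) *
        laurentMonomial (m - m f • β) := by
  rw [eliminate, laurentMonomial, AddMonoidAlgebra.lift_single, one_smul]
  rfl

theorem eliminate_binomial {f : V} {β : V → ℤ} (hβ : β f = 1) :
    eliminate f β (1 + laurentMonomial β) = 0 := by
  rw [map_add, map_one, eliminate_laurentMonomial, hβ, one_smul, sub_self, laurentMonomial_zero]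
  simp

/-- Modulo 1 + x ^ β one has x ^ β = -1, so x ^ m = (x ^ β) ^ (m f) · x ^ (m - m f • β) is congruent
to its image under `eliminate`. Thus the kernel of `eliminate` is exactly the ideal generated by the
binomial. -/
theorem binomial_dvd_iff {f : V} {β : V → ℤ} (hβ : β f = 1) (z : LaurentRing V) :
    1 + laurentMonomial β ∣ z ↔ eliminate f β z = 0 := by
  constructor
  · rintro ⟨w, rfl⟩
    rw [map_mul, eliminate_binomial hβ, zero_mul]
  · intro hz
    let I : Ideal (LaurentRing V) := Ideal.span {1 + laurentMonomial β}
    let π : LaurentRing V →ₐ[ℤ] LaurentRing V ⧸ I := (Ideal.Quotient.mk I).toIntAlgHom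
    have hπ : ∀ z, π z = Ideal.Quotient.mk I z := fun _ => rfl
    have hu : Units.map (π : LaurentRing V →* LaurentRing V ⧸ I)
        (laurentMonomialUnit (Multiplicative.ofAdd β)) = -1 := by
      ext
      have h0 : Ideal.Quotient.mk I (1 + laurentMonomial β) = 0 :=
        Ideal.Quotient.eq_zero_iff_mem.2 (Ideal.mem_span_singleton_self _)
      rw [map_add, map_one] at h0
      exact (neg_eq_of_add_eq_zero_right h0).symm
    have h : π.comp (eliminate f β) = π := by
      apply laurent_algHom_ext
      intro m
      have hm : (Multiplicative.ofAdd m) = Multiplicative.ofAdd β ^ (m f) *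
          Multiplicative.ofAdd (m - m f • β) := by
        rw [← ofAdd_zsmul, ← ofAdd_add]
        congr 1
        abel
      rw [AlgHom.comp_apply, eliminate_laurentMonomial, map_mul]
      conv_rhs => rw [← coe_laurentMonomialUnit, hm, map_mul, Units.val_mul, map_mul,
        coe_laurentMonomialUnit, map_zpow]
      congr 1
      have := congrArg (fun v : (LaurentRing V ⧸ I)ˣ => ((v ^ (m f) : (LaurentRing V ⧸ I)ˣ) :
        LaurentRing V ⧸ I)) hu
      rw [← map_zpow] at this
      refine Eq.trans ?_ this.symm
      have h1 : Units.map (π : LaurentRing V →* LaurentRing V ⧸ I) (-1) = -1 := by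
        ext
        simp
      rw [← h1, ← map_zpow]
      rfl
    have := DFunLike.congr_fun h z
    rw [AlgHom.comp_apply, hz, map_zero, hπ] at this
    exact Ideal.mem_span_singleton.1 (Ideal.Quotient.eq_zero_iff_mem.1 this.symm)

/-- The ideal is the kernel of a homomorphism into a domain. That the binomial is nonzero is seen by
sending all variables to 1, which gives 2. -/
theorem prime_binomial {f : V} {β : V → ℤ} (hβ : β f = 1) :
    Prime (1 + laurentMonomial β : LaurentRing V) := by
  refine ⟨?_, ?_, ?_⟩
  · intro h
    have := congrArg (AddMonoidAlgebra.lift ℤ ℤ (V → ℤ) 1) h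
    rw [map_add, map_one, map_zero, laurentMonomial, AddMonoidAlgebra.lift_single] at this
    simp at this
  · intro h
    have := h.map (eliminate f β)
    rw [eliminate_binomial hβ] at this
    exact not_isUnit_zero this
  · intro a b h
    rw [binomial_dvd_iff hβ, map_mul, mul_eq_zero] at h
    rwa [binomial_dvd_iff hβ, binomial_dvd_iff hβ]

end Prime

/-! ### Clearing denominators -/

section Denominators

variable {V : Type*} [Fintype V]

/-- A positive function on positive real points is a Laurent polynomial. -/
def IsLaurent (F : (V → PosReal) → PosReal) : Prop :=
  ∃ z : LaurentRing V, ∀ u, posEval u z = posRealHom (F u)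

theorem posRealHom_monomial (u : V → PosReal) (m : V → ℤ) :
    posRealHom (monomial u m) = ∏ i, posRealHom (u i) ^ m i := by
  rw [monomial, map_prod]
  exact Finset.prod_congr rfl fun i _ => Positive.coe_zpow _ _

/-- Substituting Laurent polynomials D i into a Laurent polynomial may produce negative powers of
the D i; a large power of their product removes them. For one monomial the sum of the absolute
values of the exponents suffices. -/
theorem exists_clear_denominators {U : (V → PosReal) → V → PosReal} {D : V → LaurentRing V}
    (hD : ∀ i u, posEval u (D i) = posRealHom (U u i)) (z : LaurentRing V) :
    ∃ (N : ℕ) (w : LaurentRing V),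
      ∀ u, posEval (U u) z * posEval u ((∏ i, D i) ^ N) = posEval u w := by
  induction z using laurent_induction with
  | zero => exact ⟨0, 0, fun u => by simp⟩
  | add a b ha hb =>
    obtain ⟨N, w, h⟩ := ha
    obtain ⟨N', w', h'⟩ := hb
    refine ⟨N + N', w * (∏ i, D i) ^ N' + w' * (∏ i, D i) ^ N, fun u => ?_⟩
    rw [map_add, map_add, map_mul, map_mul, ← h, ← h', pow_add, map_mul]
    ring
  | smul_monomial c m =>
    refine ⟨∑ i, (m i).natAbs,
      c • ∏ i, D i ^ (m i + ((∑ i, (m i).natAbs : ℕ) : ℤ)).toNat, fun u => ?_⟩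
    rw [map_zsmul, map_zsmul, posEval_laurentMonomial, posRealHom_monomial, smul_mul_assoc]
    congr 1
    rw [← Finset.prod_pow, map_prod, map_prod, ← Finset.prod_mul_distrib]
    refine Finset.prod_congr rfl fun i _ => ?_
    rw [map_pow, map_pow, hD, ← zpow_natCast, ← zpow_natCast,
      ← zpow_add₀ (posRealHom_ne_zero _)]
    congr 1
    have : (m i).natAbs ≤ ∑ i, (m i).natAbs :=
      Finset.single_le_sum (f := fun i => (m i).natAbs) (fun _ _ => Nat.zero_le _)
        (Finset.mem_univ i)
    omega

/-- A function that is a Laurent polynomial in two systems of Laurent polynomials is itself a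
Laurent polynomial if the product of the first system is prime and divides no element of the
second one. -/
theorem isLaurent_of_coprime {U U' : (V → PosReal) → V → PosReal} {D D' : V → LaurentRing V}
    (hD : ∀ i u, posEval u (D i) = posRealHom (U u i))
    (hD' : ∀ i u, posEval u (D' i) = posRealHom (U' u i))
    (hp : Prime (∏ i, D i)) (hdvd : ∀ i, ¬ (∏ i, D i) ∣ D' i) {F : (V → PosReal) → PosReal}
    (h : ∃ z, ∀ u, posEval (U u) z = posRealHom (F u))
    (h' : ∃ z, ∀ u, posEval (U' u) z = posRealHom (F u)) : IsLaurent F := by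
  obtain ⟨z, hz⟩ := h
  obtain ⟨z', hz'⟩ := h'
  obtain ⟨N, w, hw⟩ := exists_clear_denominators hD z
  obtain ⟨N', w', hw'⟩ := exists_clear_denominators hD' z'
  -- Both sides represent F times the two denominators. As the prime ∏ D i does not divide ∏ D' i,
  -- its N-th power must divide w.
  have e : w * (∏ i, D' i) ^ N' = w' * (∏ i, D i) ^ N := by
    apply laurent_ext_posEval
    intro u
    rw [map_mul, map_mul, ← hw, ← hw', hz, hz']
    ring
  have hnd : ¬ (∏ i, D i) ∣ (∏ i, D' i) ^ N' := by
    intro hd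
    obtain ⟨i, -, hi⟩ := (Prime.dvd_finsetProd_iff hp _).1 (hp.dvd_of_dvd_pow hd)
    exact hdvd i hi
  obtain ⟨y, hy⟩ := hp.pow_dvd_of_dvd_mul_right N hnd ⟨w', e.trans (mul_comm _ _)⟩
  refine ⟨y, fun u => ?_⟩
  have h1 := hw u
  rw [hy, hz, map_mul, mul_comm] at h1
  have h2 : posEval u ((∏ i, D i) ^ N) ≠ 0 := by
    rw [map_pow, map_prod]
    refine pow_ne_zero _ (Finset.prod_ne_zero_iff.2 fun i _ => ?_)
    rw [hD]
    exact posRealHom_ne_zero _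
  exact (mul_left_cancel₀ h2 h1).symm

end Denominators

/-! ### The Laurent phenomenon at positive real points -/

section Step

variable {V : Type*} [Fintype V] [DecidableEq V]

/-- A rational point at which `1 + x ^ β` vanishes if `β f = 1` and `β j = 0`. -/
def testPoint (f j : V) : V → ℚˣ := fun i =>
  if i = f then -1 else if i = j then Units.mk0 2 two_ne_zero else 1

/-- Evaluation at `testPoint`. -/
def testEval (f j : V) : LaurentRing V →ₐ[ℤ] ℚ := evalHom (Units.coeHom ℚ) (testPoint f j)

theorem testEval_laurentMonomial {f j : V} (h : f ≠ j) (m : V → ℤ) :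
    testEval f j (laurentMonomial m) = (-1) ^ m f * 2 ^ m j := by
  have : monomial (testPoint f j) m = (-1) ^ m f * (Units.mk0 (2 : ℚ) two_ne_zero) ^ m j := by
    rw [monomial, ← Finset.mul_prod_erase _ _ (Finset.mem_univ f),
      ← Finset.mul_prod_erase _ _ (Finset.mem_erase.2 ⟨h.symm, Finset.mem_univ j⟩),
      Finset.prod_eq_one]
    · simp [testPoint, h.symm]
    · intro i hi
      simp only [Finset.mem_erase] at hi
      simp [testPoint, hi.1, hi.2.1]
  rw [testEval, evalHom_laurentMonomial, this]
  simp

theorem testEval_laurentMonomial_ne_zero {f j : V} (h : f ≠ j) (m : V → ℤ) :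
    testEval f j (laurentMonomial m) ≠ 0 := by
  rw [testEval_laurentMonomial h]
  exact mul_ne_zero (zpow_ne_zero _ (by norm_num)) (zpow_ne_zero _ two_ne_zero)

/-- Replacing one entry of a system of functions and of the Laurent polynomials representing it. -/
theorem posEval_update {U : (V → PosReal) → V → PosReal} {D : V → LaurentRing V} {k : V}
    {F : (V → PosReal) → PosReal} {p : LaurentRing V}
    (hD : ∀ i u, posEval u (D i) = posRealHom (U u i))
    (hp : ∀ u, posEval u p = posRealHom (F u)) (i : V) (u : V → PosReal) :
    posEval u (Function.update D k p i) = posRealHom (Function.update (U u) k (F u) i) := by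
  by_cases h : i = k
  · subst h
    simp [hp]
  · simp [h, hD]

/-- The clusters after j and after j, k, j are expanded explicitly in the initial one: ρ is x_j', p
is x_k', q is x_j''. The vertex f makes r = 1 + x ^ β linear in x_f and hence prime. The product of
the first cluster is r up to a unit, and evaluation at `testPoint`, where r vanishes, shows that r
divides neither p nor q. -/
theorem isLaurent_of_mutations {B : V → V → ℤ} (hB : ∀ i j, B j i = -B i j) {j k f : V}
    (hjk : j ≠ k) (hfj : f ≠ j) (hfk : f ≠ k) (hBj : B f j = 1) (hBk : B f k = 0)
    (hc : 0 ≤ B k j) {F : (V → PosReal) → PosReal}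
    (h1 : ∃ z, ∀ u, posEval (mutateVars B j u) z = posRealHom (F u))
    (h3 : ∃ z, ∀ u, posEval (run [j, k, j] B u) z = posRealHom (F u)) : IsLaurent F := by
  obtain ⟨c, hc⟩ := Int.eq_ofNat_of_zero_le hc
  set B₁ := mutateMatrix B j with hB₁
  set B₂ := mutateMatrix B₁ k with hB₂
  have hskew₁ : ∀ i j, B₁ j i = -B₁ i j := mutateMatrix_skew hB j
  have hskew₂ : ∀ i j, B₂ j i = -B₂ i j := mutateMatrix_skew hskew₁ k
  have hB₁jk : B₁ j k = c := by rw [hB₁, mutateMatrix_left, hB k j, neg_neg, hc]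
  have hB₁kj : B₁ k j = -c := by rw [hskew₁, hB₁jk]
  have hB₂kj : B₂ k j = c := by rw [hB₂, mutateMatrix_left, hB₁kj, neg_neg]
  have hBjj := skew_self hB j
  have hB₁kk := skew_self hskew₁ k
  have hB₂jj := skew_self hskew₂ j
  -- the new variable at `j` is `ρ`
  set β : V → ℤ := fun i => B i j with hβ
  obtain ⟨r, hr⟩ : ∃ z : LaurentRing V, z = 1 + laurentMonomial β := ⟨_, rfl⟩
  have hr_prime : Prime r := hr ▸ prime_binomial (f := f) hBj
  set μ : V → ℤ := (fun i => max (-B i j) 0) - Pi.single j 1 with hμ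
  obtain ⟨ρ, hρ⟩ : ∃ z : LaurentRing V, z = laurentMonomial μ * r := ⟨_, rfl⟩
  have hρr : Associated ρ r :=
    hρ ▸ (associated_isUnit_mul_left_iff (isUnit_laurentMonomial μ)).2 (Associated.refl r)
  have eval_ρ : ∀ u, posEval u ρ = posRealHom (exchange B u j / u j) := by
    intro u
    rw [hρ, hr, map_mul, map_add, map_one, posEval_laurentMonomial, posEval_laurentMonomial,
      exchange_eq, hμ, monomial_sub, monomial_single, zpow_one, mul_div_right_comm, map_mul,
      posRealHom_add, map_one]
  -- the new variable at `k` is `p`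
  set ζ : V → ℤ := fun i => if i = j then 0 else B₁ i k with hζ
  obtain ⟨w, hw⟩ : ∃ z : LaurentRing V, z = ρ ^ c * laurentMonomial ζ := ⟨_, rfl⟩
  have eval_w : ∀ u, posEval u w =
      posRealHom (monomial (mutateVars B j u) fun i => B₁ i k) := by
    intro u
    have e : (fun i => B₁ i k) = Pi.single j (c : ℤ) + ζ := by
      funext i
      by_cases hi : i = j
      · subst hi
        simp [hζ, hB₁jk]
      · simp [hζ, hi]
    rw [hw, map_mul, map_pow, eval_ρ, posEval_laurentMonomial, e, mutateVars, monomial_add,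
      monomial_single, monomial_update_of_eq_zero _ _ _ (by simp [hζ]), Function.update_self,
      zpow_natCast, map_mul, map_pow]
  set ν : V → ℤ := (fun i => max (-B₁ i k) 0) - Pi.single k 1 with hν
  obtain ⟨p, hp⟩ : ∃ z : LaurentRing V, z = laurentMonomial ν * (1 + w) := ⟨_, rfl⟩
  have eval_p : ∀ u, posEval u p =
      posRealHom (exchange B₁ (mutateVars B j u) k / mutateVars B j u k) := by
    intro u
    have hmon : monomial (mutateVars B j u) (fun i => max (-B₁ i k) 0) =
        monomial u fun i => max (-B₁ i k) 0 :=
      monomial_update_of_eq_zero _ _ _ (by simp [hB₁jk])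
    rw [hp, map_mul, map_add, map_one, posEval_laurentMonomial, eval_w, exchange_eq, hν,
      monomial_sub, monomial_single, zpow_one, hmon, mutateVars_of_ne _ _ hjk.symm,
      mul_div_right_comm, map_mul, posRealHom_add, map_one]
  -- the second new variable at `j` is `q`
  obtain ⟨G, hG⟩ : ∃ z : LaurentRing V, z = ∑ l ∈ Finset.range c, (1 + w) ^ l := ⟨_, rfl⟩
  obtain ⟨κ, hκ⟩ : ∃ z : LaurentRing V,
      z = 1 + laurentMonomial μ * ρ ^ (c - 1) * laurentMonomial ζ * G := ⟨_, rfl⟩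
  -- This is the cancellation that makes q a Laurent polynomial: (1 + w) ^ c = 1 + w G, and both 1 +
  -- x ^ β = r and w G are multiples of r. For c = 0 the truncated exponent c - 1 is harmless since
  -- G = 0.
  have hrκ : r * κ = laurentMonomial β + (1 + w) ^ c := by
    have h0 : (1 + w) ^ c = 1 + w * G := by
      have := mul_geom_sum (1 + w) c
      rw [add_sub_cancel_left, ← hG] at this
      rw [this]
      ring
    have h1 : ρ * ρ ^ (c - 1) * G = ρ ^ c * G := by
      rcases Nat.eq_zero_or_pos c with h | h
      · simp [hG, h]
      · rw [mul_pow_sub_one h.ne']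
    have h2 : r * κ = r + laurentMonomial μ * r * ρ ^ (c - 1) * laurentMonomial ζ * G := by
      rw [hκ]
      ring
    rw [h2, ← hρ, h0, hw, hr]
    linear_combination laurentMonomial ζ * h1
  set η : V → ℤ := fun i => max (-B₂ i j) 0 with hη
  obtain ⟨q, hq⟩ : ∃ z : LaurentRing V, z = laurentMonomial (η - β - μ) * κ := ⟨_, rfl⟩
  have hρq : ρ * q * laurentMonomial β =
      laurentMonomial η * (laurentMonomial β + (1 + w) ^ c) := by
    have h0 : laurentMonomial η =
        laurentMonomial (η - β - μ) * laurentMonomial β * laurentMonomial μ := by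
      rw [← laurentMonomial_add, ← laurentMonomial_add]
      congr 1
      abel
    rw [← hrκ, h0, hq, hρ]
    ring
  have eval_q : ∀ u, posEval u q =
      posRealHom (exchange B₂ (run [j, k] B u) j / run [j, k] B u j) := by
    intro u
    have h0 := congrArg (posEval u) hρq
    have hj : run [j, k] B u j = mutateVars B j u j := mutateVars_of_ne _ _ hjk
    -- The y-variable at j is inverted by the mutation at j and then multiplied by (1 + y_k) ^ c by
    -- the mutation at k.
    have hy : (monomial (run [j, k] B u) fun i => B₂ i j) =
        (monomial u β)⁻¹ * (1 + monomial (mutateVars B j u) fun i => B₁ i k) ^ c := by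
      have := monomial_mutate_of_ne hB₁kk hjk (by rw [hB₁kj]; omega) (mutateVars B j u)
      rw [hB₁kj, neg_neg, zpow_natCast, hB₁, monomial_mutate_self hBjj] at this
      exact this
    have hmon : monomial (run [j, k] B u) η = monomial u η := by
      change monomial (mutateVars B₁ k (mutateVars B j u)) η = _
      rw [mutateVars, monomial_update_of_eq_zero _ _ _ (by simp [hη, hB₂kj]), mutateVars,
        monomial_update_of_eq_zero _ _ _ (by simp [hη, hB₂jj])]
    rw [map_mul, map_mul, map_mul, map_add, map_pow, map_add, map_one, eval_ρ, eval_w,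
      posEval_laurentMonomial, posEval_laurentMonomial] at h0
    rw [exchange_eq, hj, hy, hmon, mutateVars_self, map_div, map_mul, posRealHom_add, map_one,
      map_mul, map_inv, map_pow, posRealHom_add, map_one]
    have ha := posRealHom_ne_zero (exchange B u j / u j)
    have hb := posRealHom_ne_zero (monomial u β)
    rw [eq_div_iff ha]
    refine mul_right_cancel₀ hb ?_
    rw [mul_comm (posEval u q), h0, mul_assoc, add_mul, one_mul, mul_right_comm, inv_mul_cancel₀ hb,
      one_mul]
  -- none of these is divisible by `r`
  have test_r : testEval f j r = 0 := by
    rw [hr, map_add, map_one, testEval_laurentMonomial hfj, hβ]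
    simp [hBj, hBjj]
  have test_ρ : testEval f j ρ = 0 := by rw [hρ, map_mul, test_r, mul_zero]
  have not_dvd : ∀ z, testEval f j z ≠ 0 → ¬ r ∣ z := by
    rintro z hz ⟨y, rfl⟩
    rw [map_mul, test_r, zero_mul] at hz
    exact hz rfl
  have test_ζ : testEval f j (laurentMonomial ζ) = (-1) ^ ζ f := by
    rw [testEval_laurentMonomial hfj]
    simp [hζ]
  have hr_p : ¬ r ∣ p := by
    apply not_dvd
    rw [hp, map_mul]
    refine mul_ne_zero (testEval_laurentMonomial_ne_zero hfj _) ?_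
    rw [hw, map_add, map_one, map_mul, map_pow, test_ρ, test_ζ]
    rcases Nat.eq_zero_or_pos c with h | h
    -- If c = 0, the mutation at j leaves B f k = 0 unchanged, so w evaluates to 1 and 1 + w to 2.
    · have : ζ f = 0 := by
        have hBkj : B j k = 0 := by rw [hB k j, hc, h]; rfl
        simp [hζ, hfj, hB₁, mutateMatrix_of_ne B hfj hjk.symm, hBk, hBkj]
      rw [this, h]
      norm_num
    · rw [zero_pow h.ne']
      norm_num
  have hr_q : ¬ r ∣ q := by
    apply not_dvd
    rw [hq, map_mul]
    refine mul_ne_zero (testEval_laurentMonomial_ne_zero hfj _) ?_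
    have hμj : μ j = -1 := by simp [hμ, hBjj]
    rw [hκ, map_add, map_one, map_mul, map_mul, map_mul, map_pow, test_ρ, test_ζ,
      testEval_laurentMonomial hfj, hμj]
    -- The value of κ is 1 if c = 0, because G = 0, and also if c ≥ 2, because ρ vanishes. If c = 1
    -- it is 1 ± 1/2: the coordinate 2 at j is chosen to keep this nonzero.
    rcases c with _ | _ | c
    · simp [hG]
    · simp only [hG, zero_add, Finset.range_one, Finset.sum_singleton, pow_zero, map_one,
        Nat.sub_self, mul_one]
      have hsign : ∀ n : ℤ, (-1 : ℚ) ^ n = 1 ∨ (-1 : ℚ) ^ n = -1 := fun n =>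
        (Int.even_or_odd n).imp Even.neg_one_zpow Odd.neg_one_zpow
      rcases hsign (μ f) with h | h <;> rcases hsign (ζ f) with h' | h' <;>
        rw [h, h'] <;> norm_num
    · simp
  let x₀ : V → LaurentRing V := fun i => laurentMonomial (Pi.single i 1)
  have hD₀ : ∀ i (u : V → PosReal), posEval u (x₀ i) = posRealHom (u i) := by
    intro i u
    rw [posEval_laurentMonomial, monomial_single, zpow_one]
  have hD₁ : ∀ i u, posEval u (Function.update x₀ j ρ i) =
      posRealHom (mutateVars B j u i) := posEval_update (U := id) hD₀ eval_ρ
  have hD₂ : ∀ i u, posEval u (Function.update (Function.update x₀ j ρ) k p i) =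
      posRealHom (run [j, k] B u i) := posEval_update hD₁ eval_p
  have hD₃ : ∀ i u,
      posEval u (Function.update (Function.update (Function.update x₀ j ρ) k p) j q i) =
      posRealHom (run [j, k, j] B u i) := posEval_update hD₂ eval_q
  have hprod : Associated r
      (∏ i, Function.update x₀ j ρ i) := by
    rw [← Finset.mul_prod_erase _ _ (Finset.mem_univ j), Function.update_self]
    refine hρr.symm.trans ?_
    refine (associated_mul_isUnit_right_iff ?_).2 (Associated.refl ρ)
    refine IsUnit.prod_iff.2 fun i hi => ?_
    rw [Function.update_of_ne (Finset.ne_of_mem_erase hi)]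
    exact isUnit_laurentMonomial _
  refine isLaurent_of_coprime hD₁ hD₃ (hprod.prime hr_prime) (fun i hi => ?_) h1 h3
  replace hi := hprod.dvd.trans hi
  by_cases hij : i = j
  · subst hij
    rw [Function.update_self] at hi
    exact hr_q hi
  rw [Function.update_of_ne hij] at hi
  by_cases hik : i = k
  · subst hik
    rw [Function.update_self] at hi
    exact hr_p hi
  rw [Function.update_of_ne hik, Function.update_of_ne hij] at hi
  exact hr_prime.not_isUnit (isUnit_of_dvd_unit hi (isUnit_laurentMonomial _))

end Step

/-! ### Induction on the number of mutations -/

section Laurent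

/-- The exchange matrix with one additional vertex, joined to `j` only. -/
def extendMatrix {V : Type*} [DecidableEq V] (B : V → V → ℤ) (j : V) :
    Option V → Option V → ℤ
  | some a, some b => B a b
  | none, some b => if b = j then 1 else 0
  | some a, none => if a = j then -1 else 0
  | none, none => 0

theorem extendMatrix_skew {V : Type*} [DecidableEq V] {B : V → V → ℤ}
    (hB : ∀ i j, B j i = -B i j) (j : V) (a b : Option V) :
    extendMatrix B j b a = -extendMatrix B j a b := by
  rcases a with _ | a <;> rcases b with _ | b
  · rfl
  · simp only [extendMatrix]
    split_ifs <;> rfl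
  · simp only [extendMatrix]
    split_ifs <;> rfl
  · exact hB a b

/-- This removes the auxiliary vertex once it has served to make the exchange binomial prime. -/
theorem IsLaurent.comp_extend {V : Type*} [Fintype V] {F : (Option V → PosReal) → PosReal}
    (hF : IsLaurent F) : IsLaurent fun u : V → PosReal => F fun o => o.elim 1 u := by
  obtain ⟨z, hz⟩ := hF
  have h : ∃ w : LaurentRing V, ∀ u, posEval u w = posEval (fun o : Option V => o.elim 1 u) z := by
    clear hz
    induction z using laurent_induction with
    | zero => exact ⟨0, fun u => by rw [map_zero, map_zero]⟩
    | add a b ha hb =>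
      obtain ⟨w, hw⟩ := ha
      obtain ⟨w', hw'⟩ := hb
      exact ⟨w + w', fun u => by rw [map_add, map_add, hw, hw']⟩
    | smul_monomial c m =>
      refine ⟨c • laurentMonomial fun i => m (some i), fun u => ?_⟩
      rw [map_zsmul, map_zsmul, posEval_laurentMonomial, posEval_laurentMonomial]
      simp [monomial, Fintype.prod_option]
  obtain ⟨w, hw⟩ := h
  exact ⟨w, fun u => (hw u).trans (hz _)⟩

/-- The Laurent phenomenon. -/
theorem isLaurent_run (d : ℕ) : ∀ {V : Type} [Fintype V] [DecidableEq V] {B : V → V → ℤ},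
    (∀ i j, B j i = -B i j) → ∀ (ks : List V), ks.length = d → ∀ i : V,
      IsLaurent fun u => run ks B u i := by
  induction d using Nat.strong_induction_on with
  | _ d ih =>
    -- mutations `j`, `k` for which a vertex as in `isLaurent_of_mutations` exists
    have key : ∀ {V : Type} [Fintype V] [DecidableEq V] {B : V → V → ℤ},
        (∀ i j, B j i = -B i j) → ∀ {j k f : V} (ks : List V), ks.length + 2 = d → j ≠ k →
        f ≠ j → f ≠ k → B f j = 1 → B f k = 0 → 0 ≤ B k j → ∀ i : V,
        IsLaurent fun u => run (j :: k :: ks) B u i := by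
      intro V _ _ B hB j k f ks hd hjk hfj hfk hBj hBk hc i
      have hB₁ := mutateMatrix_skew hB j
      have hB₂ := mutateMatrix_skew hB₁ k
      have hB₃ := mutateMatrix_skew hB₂ j
      obtain ⟨z, hz⟩ := ih (d - 1) (by omega) hB₁ (k :: ks) (by simp; omega) i
      -- From the cluster after j, k, j, one more mutation at j returns to the cluster after j, k,
      -- from which `ks` continues; the path has length d - 1, one less than the original.
      obtain ⟨z', hz'⟩ := ih (d - 1) (by omega) hB₃ (j :: ks) (by simp; omega) i
      have h₁ : ∀ u, posEval (mutateVars B j u) z = posRealHom (run (j :: k :: ks) B u i) :=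
        fun u => hz (mutateVars B j u)
      have h₃ : ∀ u, posEval (run [j, k, j] B u) z' =
          posRealHom (run (j :: k :: ks) B u i) := by
        intro u
        have h := congrFun (run_cancel (skew_self hB₂ j) ks (run [j, k] B u)) i
        exact (hz' (run [j, k, j] B u)).trans (congrArg posRealHom h)
      exact isLaurent_of_mutations hB hjk hfj hfk hBj hBk hc ⟨z, h₁⟩ ⟨z', h₃⟩
    have extend : ∀ {V : Type} [Fintype V] [DecidableEq V] {B : V → V → ℤ},
        (∀ i j, B j i = -B i j) → ∀ {j k : V} (ks : List V), ks.length + 2 = d → j ≠ k →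
        0 ≤ B k j → ∀ i : V, IsLaurent fun u => run (j :: k :: ks) B u i := by
      intro V _ _ B hB j k ks hd hjk hc i
      have h := (key (extendMatrix_skew hB j) (j := some j) (k := some k) (f := none)
        (ks.map some) (by simpa using hd) (by simpa using hjk) (by simp) (by simp)
        (by simp [extendMatrix]) (by simp [extendMatrix, hjk.symm]) hc (some i)).comp_extend
      have e : (fun u => run (j :: k :: ks) B u i) = fun u : V → PosReal =>
          run (some j :: some k :: ks.map some) (extendMatrix B j) (fun o => o.elim 1 u)
            (some i) := by
        funext u
        exact (run_map_some (B' := extendMatrix B j) (u' := fun o => o.elim 1 u)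
          (fun _ _ => rfl) (fun _ => rfl) rfl (j :: k :: ks) i).symm
      rw [e]
      exact h
    intro V _ _ B hB ks hd i
    match ks, hd with
    | [], _ =>
      exact ⟨laurentMonomial (Pi.single i 1), fun u => by
        rw [posEval_laurentMonomial, monomial_single, zpow_one]; rfl⟩
    | [j], _ =>
      by_cases hi : i = j
      · subst hi
        refine ⟨laurentMonomial ((fun a => max (B a i) 0) - Pi.single i 1) +
          laurentMonomial ((fun a => max (-B a i) 0) - Pi.single i 1), fun u => ?_⟩
        change _ = posRealHom (mutateVars B i u i)
        rw [mutateVars_self, exchange, map_add, posEval_laurentMonomial, posEval_laurentMonomial,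
          monomial_sub, monomial_sub, monomial_single, zpow_one, map_div, map_div, map_div,
          posRealHom_add, add_div]
      · refine ⟨laurentMonomial (Pi.single i 1), fun u => ?_⟩
        change _ = posRealHom (mutateVars B j u i)
        rw [mutateVars_of_ne _ _ hi, posEval_laurentMonomial, monomial_single, zpow_one]
    | j :: k :: ks, hd =>
      by_cases hjk : j = k
      · subst hjk
        have e : (fun u => run (j :: j :: ks) B u i) = fun u => run ks B u i := by
          funext u
          rw [run, run_cancel (skew_self hB j)]
        rw [e]
        exact ih (d - 2) (by simp at hd; omega) hB ks (by simp at hd; omega) i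
      · rcases le_total 0 (B k j) with hc | hc
        · exact extend hB ks hd hjk hc i
        -- Reversing all arrows does not change the cluster variables, so the sign of B k j may be
        -- chosen.
        · have h := extend (B := -B) (fun a b => by simp [hB a b]) ks hd hjk (by simpa using hc) i
          simpa only [run_neg] using h

end Laurent

/-! ### The Laurent phenomenon for cluster algebras -/

section Seeds

variable {n : ℕ}

/-- The skew-symmetric matrix of a quiver. -/
def ClusterQuiver.exchangeMatrix (Q : ClusterQuiver n) : Fin n → Fin n → ℤ :=
  fun i j => (Q.arrows i j : ℤ) - Q.arrows j i

theorem ClusterQuiver.exchangeMatrix_skew (Q : ClusterQuiver n) (i j : Fin n) :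
    Q.exchangeMatrix j i = -Q.exchangeMatrix i j := by
  simp [exchangeMatrix]

theorem ClusterQuiver.max_exchangeMatrix (Q : ClusterQuiver n) (i j : Fin n) :
    max (Q.exchangeMatrix i j) 0 = Q.arrows i j := by
  have := Q.no_two_cycles i j
  simp only [exchangeMatrix]
  omega

theorem ClusterQuiver.max_neg_exchangeMatrix (Q : ClusterQuiver n) (i j : Fin n) :
    max (-Q.exchangeMatrix i j) 0 = Q.arrows j i := by
  rw [← Q.exchangeMatrix_skew, Q.max_exchangeMatrix]

theorem ClusterQuiver.exchangeMatrix_mutate (Q : ClusterQuiver n) (k : Fin n) :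
    (Q.mutate k).exchangeMatrix = mutateMatrix Q.exchangeMatrix k := by
  funext i j
  by_cases h : i = k ∨ j = k
  · have h' : j = k ∨ i = k := h.symm
    simp [exchangeMatrix, mutateMatrix, mutate, h, h']
  · have h' : ¬(j = k ∨ i = k) := fun h' => h h'.symm
    simp only [mutateMatrix, h, if_false, Q.max_exchangeMatrix, Q.max_neg_exchangeMatrix]
    simp only [exchangeMatrix, mutate, h, h', if_false]
    have e : ∀ a b : ℕ, ((a - b : ℕ) : ℤ) - ((b - a : ℕ) : ℤ) = a - b := fun a b => by omega
    rw [e]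
    push_cast
    ring

/-- The initial cluster variables as elements of the Laurent ring. -/
def polynomialToLaurent (n : ℕ) : MvPolynomial (Fin n) ℤ →ₐ[ℤ] Laurent n :=
  MvPolynomial.aeval fun i => laurentMonomial (Pi.single i 1)

theorem laurentEval_laurentMonomial (u : Fin n → (AmbientField n)ˣ) (m : Fin n → ℤ) :
    laurentEval u (laurentMonomial m) = (monomial u m : (AmbientField n)ˣ) := by
  rw [laurentEval_eq_evalHom, evalHom_laurentMonomial]
  rfl

theorem laurentEval_xUnit_single (i : Fin n) :
    laurentEval xUnit (laurentMonomial (Pi.single i 1)) = x i := by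
  rw [laurentEval_laurentMonomial, monomial_single, zpow_one]
  rfl

theorem laurentEval_polynomialToLaurent (p : MvPolynomial (Fin n) ℤ) :
    laurentEval xUnit (polynomialToLaurent n p) =
      algebraMap (MvPolynomial (Fin n) ℤ) (AmbientField n) p := by
  induction p using MvPolynomial.induction_on with
  | C a => simp
  | add p q hp hq => rw [map_add, map_add, map_add, hp, hq]
  | mul_X p i hp =>
    rw [map_mul, map_mul, map_mul, hp, polynomialToLaurent, MvPolynomial.aeval_X,
      laurentEval_xUnit_single]
    rfl

theorem exists_polynomialToLaurent (z : Laurent n) :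
    ∃ m p, z * laurentMonomial m = polynomialToLaurent n p := by
  have aux : ∀ m : Fin n → ℕ, ∃ p, laurentMonomial (fun i => (m i : ℤ)) =
      polynomialToLaurent n p := by
    intro m
    refine ⟨∏ i, MvPolynomial.X i ^ m i, ?_⟩
    apply laurent_ext_posEval
    intro u
    rw [posEval_laurentMonomial, polynomialToLaurent, map_prod, map_prod, posRealHom_monomial]
    refine Finset.prod_congr rfl fun i _ => ?_
    rw [map_pow, map_pow, MvPolynomial.aeval_X, posEval_laurentMonomial, monomial_single, zpow_one,
      zpow_natCast]
  -- The claim for all large N' is what survives addition, where two summands need a common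
  -- denominator.
  have h : ∃ N : ℕ, ∀ N', N ≤ N' → ∃ p,
      z * laurentMonomial (fun _ => (N' : ℤ)) = polynomialToLaurent n p := by
    induction z using laurent_induction with
    | zero => exact ⟨0, fun _ _ => ⟨0, by rw [zero_mul, map_zero]⟩⟩
    | add a b ha hb =>
      obtain ⟨N, h⟩ := ha
      obtain ⟨N₁, h₁⟩ := hb
      refine ⟨max N N₁, fun N' hN' => ?_⟩
      obtain ⟨p, hp⟩ := h N' (le_trans (le_max_left _ _) hN')
      obtain ⟨q, hq⟩ := h₁ N' (le_trans (le_max_right _ _) hN')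
      exact ⟨p + q, by rw [add_mul, hp, hq, map_add]⟩
    | smul_monomial c m =>
      refine ⟨∑ i, (m i).natAbs, fun N' hN' => ?_⟩
      obtain ⟨p, hp⟩ := aux fun i => (m i + N').toNat
      refine ⟨c • p, ?_⟩
      rw [smul_mul_assoc, ← laurentMonomial_add, map_zsmul, ← hp]
      congr 2
      funext i
      have : (m i).natAbs ≤ ∑ i, (m i).natAbs :=
        Finset.single_le_sum (f := fun i => (m i).natAbs) (fun _ _ => Nat.zero_le _)
          (Finset.mem_univ i)
      simp only [Pi.add_apply]
      omega
  obtain ⟨N, h⟩ := h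
  exact ⟨_, h N le_rfl⟩

theorem laurentEval_xUnit_injective : Function.Injective (laurentEval (n := n) xUnit) := by
  rw [injective_iff_map_eq_zero]
  intro z hz
  obtain ⟨m, p, hp⟩ := exists_polynomialToLaurent z
  have h := laurentEval_polynomialToLaurent p
  rw [← hp, map_mul, hz, zero_mul] at h
  have hp0 : p = 0 := IsFractionRing.injective (MvPolynomial (Fin n) ℤ) (AmbientField n)
    (h.symm.trans (map_zero _).symm)
  rw [hp0, map_zero] at hp
  exact (isUnit_laurentMonomial m).mul_left_eq_zero.1 hp

/-- The bridge from positive points to the field: a single Laurent polynomial represents both a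
cluster variable and the corresponding function. At the mutated vertex the polynomial supplied by
`isLaurent_run` satisfies the exchange relation at every positive point, hence in the Laurent ring,
hence in the field. -/
theorem IsSeedOf.exists_path {Q : ClusterQuiver n} {s : Seed n} (hs : IsSeedOf Q s) :
    ∃ ks : List (Fin n), s.quiver.exchangeMatrix = runMatrix ks Q.exchangeMatrix ∧
      ∀ i, ∃ z : Laurent n, laurentEval xUnit z = s.cluster i ∧
        ∀ u, posEval u z = posRealHom (run ks Q.exchangeMatrix u i) := by
  induction hs with
  | initial =>
    refine ⟨[], rfl, fun i => ⟨laurentMonomial (Pi.single i 1), laurentEval_xUnit_single i,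
      fun u => ?_⟩⟩
    rw [posEval_laurentMonomial, monomial_single, zpow_one]
    rfl
  | mutate s k _ ih =>
    obtain ⟨ks, hB, hz⟩ := ih
    choose z hz hzu using hz
    refine ⟨ks ++ [k], ?_, fun i => ?_⟩
    · rw [runMatrix_concat, ← hB]
      exact s.quiver.exchangeMatrix_mutate k
    by_cases hi : i = k
    · subst hi
      obtain ⟨z', hz'⟩ := isLaurent_run _ Q.exchangeMatrix_skew (ks ++ [i]) rfl i
      refine ⟨z', ?_, hz'⟩
      have hzi : s.cluster i ≠ 0 := by
        rw [← hz, Ne, map_eq_zero_iff _ laurentEval_xUnit_injective]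
        intro h0
        have := hzu i 1
        rw [h0, map_zero] at this
        exact posRealHom_ne_zero _ this.symm
      have key : z' * z i = ∏ a, z a ^ s.quiver.arrows a i + ∏ a, z a ^ s.quiver.arrows i a := by
        apply laurent_ext_posEval
        intro u
        rw [map_mul, hz' u, hzu]
        beta_reduce
        rw [run_concat, mutateVars_self, ← map_mul, div_mul_cancel, ← hB,
          exchange, posRealHom_add, posRealHom_monomial, posRealHom_monomial, map_add, map_prod,
          map_prod]
        simp only [s.quiver.max_exchangeMatrix, s.quiver.max_neg_exchangeMatrix, map_pow, hzu,
          zpow_natCast]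
      simp only [Seed.mutate, Function.update_self]
      rw [eq_div_iff hzi]
      have := congrArg (laurentEval xUnit) key
      simpa only [map_mul, map_add, map_prod, map_pow, hz] using this
    · refine ⟨z i, ?_, fun u => ?_⟩
      · rw [hz]
        exact (Function.update_of_ne hi _ _).symm
      · rw [hzu, run_concat, mutateVars_of_ne _ _ hi]

/-- The Laurent polynomials that are also Laurent polynomials in the cluster obtained by mutation
at `j`. -/
def adjacentLaurent {V : Type*} [Fintype V] [DecidableEq V] (B : V → V → ℤ) (j : V) :
    Subalgebra ℤ (LaurentRing V) where
  carrier := {z | ∃ w : LaurentRing V, ∀ u, posEval (mutateVars B j u) w = posEval u z}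
  mul_mem' := by
    rintro a b ⟨w, hw⟩ ⟨w', hw'⟩
    exact ⟨w * w', fun u => by rw [map_mul, map_mul, hw, hw']⟩
  add_mem' := by
    rintro a b ⟨w, hw⟩ ⟨w', hw'⟩
    exact ⟨w + w', fun u => by rw [map_add, map_add, hw, hw']⟩
  algebraMap_mem' c := ⟨algebraMap _ _ c, fun u => by rw [AlgHom.commutes, AlgHom.commutes]⟩

/-- A path `ks` from the initial seed is the path `j :: ks` from the seed mutated at j, so the
Laurent phenomenon holds relative to both clusters. -/
theorem clusterAlgebra_le (Q : ClusterQuiver n) (j : Fin n) :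
    clusterAlgebra Q ≤ (adjacentLaurent Q.exchangeMatrix j).map (laurentEval xUnit) := by
  refine Algebra.adjoin_le ?_
  rintro y ⟨s, hs, i, rfl⟩
  obtain ⟨ks, -, h⟩ := hs.exists_path
  obtain ⟨z, hz, hzu⟩ := h i
  refine ⟨z, ?_, hz⟩
  obtain ⟨w, hw⟩ := isLaurent_run _ (mutateMatrix_skew Q.exchangeMatrix_skew j) (j :: ks) rfl i
  refine ⟨w, fun u => ?_⟩
  rw [hw]
  beta_reduce
  rw [run_cancel (skew_self Q.exchangeMatrix_skew j), hzu]

theorem clusterAlgebra_le_laurentSubalgebra (Q : ClusterQuiver n) (j : Fin n) :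
    clusterAlgebra Q ≤ laurentSubalgebra n := by
  intro y hy
  obtain ⟨z, -, hz⟩ := clusterAlgebra_le Q j hy
  exact ⟨z, hz⟩

theorem mem_adjacentLaurent {Q : ClusterQuiver n} {z : Laurent n}
    (hz : laurentEval xUnit z ∈ clusterAlgebra Q) (j : Fin n) :
    z ∈ adjacentLaurent Q.exchangeMatrix j := by
  obtain ⟨z', h, hz'⟩ := clusterAlgebra_le Q j hz
  rwa [← laurentEval_xUnit_injective hz']

end Seeds

/-! ### Supports of Laurent polynomials -/

section Support

variable {V : Type*}

/-- The Laurent polynomials all of whose exponent vectors belong to a submonoid. -/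
def supportedSubalgebra (M : AddSubmonoid (V → ℤ)) : Subalgebra ℤ (LaurentRing V) where
  carrier := {z | ∀ m, z.coeff m ≠ 0 → m ∈ M}
  mul_mem' := by
    classical
    intro a b ha hb m hm
    have h := AddMonoidAlgebra.support_coeff_mul_subset a b (Finsupp.mem_support_iff.2 hm)
    obtain ⟨p, hp, q, hq, rfl⟩ := Finset.mem_add.1 h
    exact M.add_mem (ha _ (Finsupp.mem_support_iff.1 hp)) (hb _ (Finsupp.mem_support_iff.1 hq))
  add_mem' := by
    intro a b ha hb m hm
    by_cases h : a.coeff m = 0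
    · refine hb m fun h' => hm ?_
      rw [AddMonoidAlgebra.coeff_add, Finsupp.add_apply, h, h', add_zero]
    · exact ha m h
  algebraMap_mem' c := by
    intro m hm
    have : algebraMap ℤ (LaurentRing V) c = AddMonoidAlgebra.single 0 c := rfl
    rw [this, AddMonoidAlgebra.coeff_single] at hm
    rw [(Finsupp.single_apply_ne_zero.1 hm).1]
    exact M.zero_mem

theorem laurentMonomial_mem_supportedSubalgebra {M : AddSubmonoid (V → ℤ)} {m : V → ℤ}
    (hm : m ∈ M) : laurentMonomial m ∈ supportedSubalgebra M := by
  intro m' h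
  rw [laurentMonomial, AddMonoidAlgebra.coeff_single] at h
  rwa [(Finsupp.single_apply_ne_zero.1 h).1]

theorem map_supportedSubalgebra_le {A : Type*} [CommRing A] [Algebra ℤ A]
    {M : AddSubmonoid (V → ℤ)} {φ : LaurentRing V →ₐ[ℤ] A} {S : Subalgebra ℤ A}
    (h : ∀ m ∈ M, φ (laurentMonomial m) ∈ S) : (supportedSubalgebra M).map φ ≤ S := by
  rintro _ ⟨z, hz, rfl⟩
  have e : z = ∑ m ∈ z.coeff.support, z.coeff m • laurentMonomial m := by
    classical
    apply AddMonoidAlgebra.ext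
    ext m
    simp [laurentMonomial, Finsupp.single_apply]
  change φ z ∈ S
  rw [e, map_sum]
  refine S.sum_mem fun m hm => ?_
  rw [map_zsmul]
  exact S.zsmul_mem (h m (hz m (Finsupp.mem_support_iff.1 hm))) _

/-- The exponent vectors that are nonnegative at `j`. -/
def nonnegAt (j : V) : AddSubmonoid (V → ℤ) where
  carrier := {m | 0 ≤ m j}
  zero_mem' := le_refl (0 : ℤ)
  add_mem' := by
    intro a b ha hb
    rw [Set.mem_ofPred_eq] at *
    exact add_nonneg ha hb

theorem mem_nonnegAt {j : V} {m : V → ℤ} : m ∈ nonnegAt j ↔ 0 ≤ m j :=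
  Iff.of_eq (Set.mem_ofPred_eq ..)

/-- The exponent vectors that vanish on a set. -/
def zeroOn (s : Set V) : AddSubmonoid (V → ℤ) where
  carrier := {m | ∀ i ∈ s, m i = 0}
  zero_mem' := fun _ _ => rfl
  add_mem' := fun ha hb i hi => by rw [Pi.add_apply, ha i hi, hb i hi, add_zero]

theorem mem_zeroOn {s : Set V} {m : V → ℤ} : m ∈ zeroOn s ↔ ∀ i ∈ s, m i = 0 := Iff.rfl

/-- The binomial does not involve x_j, so multiplication by it respects the grading by the exponent
of x_j. The part y of z in negative degrees is therefore annihilated by the binomial, and y = 0 in a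
domain. -/
theorem mem_nonnegAt_of_binomial_mul {β : V → ℤ} {j : V} (hβ : β j = 0) {z : LaurentRing V}
    (h : (1 + laurentMonomial β) * z ∈ supportedSubalgebra (nonnegAt j)) :
    z ∈ supportedSubalgebra (nonnegAt j) := by
  classical
  let y : LaurentRing V := AddMonoidAlgebra.ofCoeff (z.coeff.filter fun m => m j < 0)
  have hy : ∀ m, y.coeff m = if m j < 0 then z.coeff m else 0 := fun m => Finsupp.filter_apply _ _ _
  have hc : ∀ (a : LaurentRing V) m,
      ((1 + laurentMonomial β) * a).coeff m = a.coeff m + a.coeff (-β + m) := by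
    intro a m
    rw [add_mul, one_mul, AddMonoidAlgebra.coeff_add, Finsupp.add_apply, laurentMonomial,
      AddMonoidAlgebra.coeff_single_mul_apply, one_mul]
  have h0 : (1 + laurentMonomial β) * y = 0 := by
    apply AddMonoidAlgebra.ext
    ext m
    rw [hc, hy, hy, Pi.add_apply, Pi.neg_apply, hβ, neg_zero, zero_add]
    split_ifs with hm
    · rw [← hc]
      by_contra hne
      exact absurd (mem_nonnegAt.1 (h m hne)) (not_le.2 hm)
    · exact add_zero 0
  have hr : (1 + laurentMonomial β : LaurentRing V) ≠ 0 := by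
    intro h
    have := congrArg (AddMonoidAlgebra.lift ℤ ℤ (V → ℤ) 1) h
    rw [map_add, map_one, map_zero, laurentMonomial, AddMonoidAlgebra.lift_single] at this
    simp at this
  have hy0 : y = 0 := (mul_eq_zero.1 h0).resolve_left hr
  intro m hm
  by_contra hneg
  have := hy m
  rw [if_pos (not_le.1 (mt mem_nonnegAt.2 hneg)), hy0] at this
  exact hm this.symm

variable [Fintype V] [DecidableEq V]

/-- Substituting x_j' = M r / x_j gives w = a + b / r ^ N: a collects the terms with a positive
power of x_j', hence of r, and b the remaining ones, in which the power of x_j is nonnegative. -/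
theorem exists_decomposition_mutate {B : V → V → ℤ} {j : V} (hB : B j j = 0)
    (w : LaurentRing V) : ∃ (N : ℕ) (a b : LaurentRing V),
      (1 + laurentMonomial fun i => B i j) ∣ a ∧ b ∈ supportedSubalgebra (nonnegAt j) ∧
      ∀ u, posEval (mutateVars B j u) w * posEval u ((1 + laurentMonomial fun i => B i j) ^ N) =
        posEval u ((1 + laurentMonomial fun i => B i j) ^ N * a + b) := by
  set r : LaurentRing V := 1 + laurentMonomial fun i => B i j with hr
  have hrmem : r ∈ supportedSubalgebra (nonnegAt j) :=
    Subalgebra.add_mem _ (Subalgebra.one_mem _)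
      (laurentMonomial_mem_supportedSubalgebra (mem_nonnegAt.2 (le_of_eq hB.symm)))
  induction w using laurent_induction with
  | zero =>
    exact ⟨0, 0, 0, dvd_zero _, Subalgebra.zero_mem _, fun u => by simp⟩
  | add w w' hw hw' =>
    obtain ⟨N, a, b, ha, hb, h⟩ := hw
    obtain ⟨N', a', b', ha', hb', h'⟩ := hw'
    refine ⟨N + N', a + a', r ^ N' * b + r ^ N * b', dvd_add ha ha', Subalgebra.add_mem _
      (Subalgebra.mul_mem _ (Subalgebra.pow_mem _ hrmem _) hb)
      (Subalgebra.mul_mem _ (Subalgebra.pow_mem _ hrmem _) hb'), fun u => ?_⟩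
    have e : r ^ (N + N') * (a + a') + (r ^ N' * b + r ^ N * b') =
        r ^ N' * (r ^ N * a + b) + r ^ N * (r ^ N' * a' + b') := by ring
    rw [e, map_add (posEval u), map_mul (posEval u), map_mul (posEval u), ← h, ← h', pow_add,
      map_mul, map_add]
    ring
  | smul_monomial c m =>
    -- the exponents after the substitution `x j ↦ ρ / x j`
    set m' : V → ℤ := m + m j • ((fun i => max (-B i j) 0) - Pi.single j 2) with hm'
    have hm'j : m' j = -m j := by
      simp [hm', hB]
      ring
    have e : ∀ u, posRealHom (monomial (mutateVars B j u) m) =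
        posRealHom (monomial u m') * posEval u r ^ (m j) := by
      intro u
      have e1 : posEval u r = posRealHom (1 + monomial u fun i => B i j) := by
        rw [hr, map_add, map_one, posEval_laurentMonomial, posRealHom_add, map_one]
      have e2 : posRealHom (1 + monomial u fun i => B i j) ^ (m j) =
          posRealHom ((1 + monomial u fun i => B i j) ^ (m j)) :=
        (Positive.coe_zpow (1 + monomial u fun i => B i j) (m j)).symm
      rw [e1, e2, ← map_mul]
      congr 1
      rw [mutateVars, monomial_update, exchange_eq, hm', monomial_add, monomial_zsmul,
        monomial_sub, monomial_single, div_div, ← zpow_two, mul_div_right_comm, mul_zpow,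
        mul_right_comm, mul_comm (_ ^ m j) (monomial u m)]
    have hrne : ∀ u, posEval u r ≠ 0 := by
      intro u
      rw [hr, map_add, map_one, posEval_laurentMonomial, ← map_one posRealHom, ← posRealHom_add]
      exact posRealHom_ne_zero _
    rcases lt_or_ge 0 (m j) with h | h
    · obtain ⟨l, hl⟩ := Int.eq_ofNat_of_zero_le h.le
      have hl0 : l ≠ 0 := by omega
      refine ⟨0, c • (laurentMonomial m' * r ^ l), 0,
        dvd_smul_of_dvd c ((dvd_pow_self r hl0).mul_left _), Subalgebra.zero_mem _, fun u => ?_⟩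
      rw [map_zsmul, posEval_laurentMonomial, e, hl, zpow_natCast, pow_zero, map_one, mul_one,
        one_mul, add_zero, map_zsmul, map_mul, map_pow, posEval_laurentMonomial]
    · refine ⟨(-m j).toNat, 0, c • laurentMonomial m', dvd_zero _, Subalgebra.zsmul_mem _
        (laurentMonomial_mem_supportedSubalgebra ?_) _, fun u => ?_⟩
      · rw [mem_nonnegAt]
        omega
      · have h' : m j = -((-m j).toNat : ℤ) := by omega
        rw [map_zsmul, posEval_laurentMonomial, e, mul_zero, zero_add, map_zsmul, map_pow,
          posEval_laurentMonomial, smul_mul_assoc, mul_assoc, ← zpow_natCast,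
          ← zpow_add₀ (hrne u), ← sub_neg_eq_add, ← h', sub_self, zpow_zero, mul_one]

/-- Modulo the exchange binomial at `j`, the Laurent polynomials that are also Laurent polynomials
in the cluster obtained by mutation at `j` are polynomial in the variable at `j`. -/
theorem exists_dvd_sub_of_mem_adjacentLaurent {B : V → V → ℤ} {j : V} (hB : B j j = 0)
    {z : LaurentRing V} (hz : z ∈ adjacentLaurent B j) :
    ∃ y ∈ supportedSubalgebra (nonnegAt j), (1 + laurentMonomial fun i => B i j) ∣ z - y := by
  obtain ⟨w, hw⟩ := hz
  obtain ⟨N, a, b, ha, hb, h⟩ := exists_decomposition_mutate hB w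
  -- Here r ^ N (z - a) = b is polynomial in x_j, and the powers of r can be divided out without
  -- creating negative exponents of x_j.
  refine ⟨z - a, ?_, by rwa [sub_sub_cancel]⟩
  have e : (1 + laurentMonomial fun i => B i j) ^ N * (z - a) = b := by
    rw [mul_sub, sub_eq_iff_eq_add']
    apply laurent_ext_posEval
    intro u
    rw [← h, hw, map_mul, mul_comm]
  have key : ∀ N : ℕ, (1 + laurentMonomial fun i => B i j) ^ N * (z - a) ∈
      supportedSubalgebra (nonnegAt j) → z - a ∈ supportedSubalgebra (nonnegAt j) := by
    intro N
    induction N with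
    | zero => rw [pow_zero, one_mul]; exact id
    | succ N ih =>
      intro h
      rw [pow_succ', mul_assoc] at h
      exact ih (mem_nonnegAt_of_binomial_mul (β := fun i => B i j) hB h)
  exact key N (e ▸ hb)

end Support

/-! ### Specialised cluster algebras -/

section Specialised

variable {n : ℕ}

theorem value_of_none {σ : Specialisation n} {i : Fin n} (h : σ i = none) :
    σ.value i = xUnit i := by
  simp [Specialisation.value, h]

theorem value_of_some {σ : Specialisation n} {i : Fin n} {a : ℤˣ} (h : σ i = some a) :
    σ.value i = Units.map (algebraMap ℤ (AmbientField n)).toMonoidHom a := by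
  simp [Specialisation.value, h]

theorem x_mem_clusterAlgebra (Q : ClusterQuiver n) (i : Fin n) : x i ∈ clusterAlgebra Q :=
  Algebra.subset_adjoin ⟨initialSeed Q, IsSeedOf.initial, i, rfl⟩

theorem zpow_mem_of_nonneg {S : Subalgebra ℤ (AmbientField n)} {u : (AmbientField n)ˣ}
    (hu : (u : AmbientField n) ∈ S) {c : ℤ} (hc : 0 ≤ c) :
    ((u ^ c : (AmbientField n)ˣ) : AmbientField n) ∈ S := by
  lift c to ℕ using hc
  rw [zpow_natCast, Units.val_pow_eq_pow_val]
  exact S.pow_mem hu _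

theorem value_zpow_mem_of_some {σ : Specialisation n} {i : Fin n} {a : ℤˣ} (h : σ i = some a)
    (S : Subalgebra ℤ (AmbientField n)) (c : ℤ) :
    ((σ.value i ^ c : (AmbientField n)ˣ) : AmbientField n) ∈ S := by
  rw [value_of_some h, ← map_zpow]
  exact S.algebraMap_mem _

theorem monomial_mem {S : Subalgebra ℤ (AmbientField n)} {u : Fin n → (AmbientField n)ˣ}
    {m : Fin n → ℤ} (h : ∀ i, ((u i ^ m i : (AmbientField n)ˣ) : AmbientField n) ∈ S) :
    ((monomial u m : (AmbientField n)ˣ) : AmbientField n) ∈ S := by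
  rw [monomial, Units.coe_prod]
  exact S.prod_mem fun i _ => h i

theorem polynomialRing_le_specialisedClusterAlgebra (Q : ClusterQuiver n) (σ : Specialisation n) :
    polynomialRing σ ≤ specialisedClusterAlgebra Q σ := by
  refine Algebra.adjoin_le ?_
  rintro _ ⟨i, hi, rfl⟩
  refine ⟨laurentMonomial (Pi.single i 1), ?_, ?_⟩
  · change laurentEval xUnit _ ∈ clusterAlgebra Q
    rw [laurentEval_xUnit_single]
    exact x_mem_clusterAlgebra Q i
  · change laurentEval σ.value _ = _
    rw [laurentEval_laurentMonomial, monomial_single, zpow_one, value_of_none hi]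
    rfl

theorem specialisedClusterAlgebra_le_map (Q : ClusterQuiver n) (σ : Specialisation n) :
    specialisedClusterAlgebra Q σ ≤
      (supportedSubalgebra (zeroOn σ.freeVariablesᶜ)).map (laurentEval xUnit) := by
  rintro _ ⟨z, -, rfl⟩
  have hz : z ∈ supportedSubalgebra (⊤ : AddSubmonoid (Fin n → ℤ)) :=
    fun _ _ => AddSubmonoid.mem_top _
  refine map_supportedSubalgebra_le (fun m _ => ?_) ⟨z, hz, rfl⟩
  rw [laurentEval_laurentMonomial]
  refine monomial_mem fun i => ?_
  rcases hi : σ i with _ | a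
  · refine ⟨laurentMonomial (Pi.single i (m i)), laurentMonomial_mem_supportedSubalgebra ?_, ?_⟩
    · rw [mem_zeroOn]
      intro l hl
      have hil : l ≠ i := by
        rintro rfl
        exact hl hi
      simp [hil]
    · change laurentEval xUnit _ = _
      rw [laurentEval_laurentMonomial, monomial_single, value_of_none hi]
  · exact value_zpow_mem_of_some hi _ _

theorem polynomialIn_le_map (σ : Specialisation n) (j : Fin n) :
    polynomialIn σ j ≤ (supportedSubalgebra (nonnegAt j)).map (laurentEval xUnit) := by
  refine Algebra.adjoin_le ?_
  have single_mem : ∀ i c, 0 ≤ (Pi.single i c : Fin n → ℤ) j →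
      ((xUnit i ^ c : (AmbientField n)ˣ) : AmbientField n) ∈
        (supportedSubalgebra (nonnegAt j)).map (laurentEval xUnit) := by
    intro i c h
    refine ⟨laurentMonomial (Pi.single i c),
      laurentMonomial_mem_supportedSubalgebra (mem_nonnegAt.2 h), ?_⟩
    change laurentEval xUnit _ = _
    rw [laurentEval_laurentMonomial, monomial_single]
  rintro y (hy | ⟨i, -, hij, hy | hy⟩)
  · rw [Set.mem_singleton_iff] at hy
    have := single_mem j 1 (by simp)
    rw [zpow_one] at this
    rwa [hy]
  · have := single_mem i 1 (by simp [hij.symm])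
    rw [zpow_one] at this
    rwa [hy]
  · have := single_mem i (-1) (by simp [hij.symm])
    rw [zpow_neg_one, Units.val_inv_eq_inv_val] at this
    rwa [hy]

/-- By injectivity of `laurentEval xUnit`, one Laurent polynomial y represents z, and the conditions
at the different free variables all constrain the exponents of this same y. The labelled variables
do not occur in y since their values are signs. -/
theorem IsPolyamorous.specialisedClusterAlgebra_eq {Q : ClusterQuiver n} {σ : Specialisation n}
    (h : IsPolyamorous Q σ) : specialisedClusterAlgebra Q σ = polynomialRing σ := by
  refine le_antisymm ?_ (polynomialRing_le_specialisedClusterAlgebra Q σ)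
  intro z hz
  obtain ⟨y, hy, hyz⟩ := specialisedClusterAlgebra_le_map Q σ hz
  change laurentEval xUnit y = z at hyz
  have hpos : ∀ j ∈ σ.freeVariables, y ∈ supportedSubalgebra (nonnegAt j) := by
    intro j hj
    obtain ⟨y', hy', h'⟩ := polynomialIn_le_map σ j ((h j hj).2 z hz)
    rwa [← laurentEval_xUnit_injective (h'.trans hyz.symm)]
  have hy' : y ∈ supportedSubalgebra
      (zeroOn σ.freeVariablesᶜ ⊓ ⨅ j ∈ σ.freeVariables, nonnegAt j) := by
    intro m hm
    simp only [AddSubmonoid.mem_inf, AddSubmonoid.mem_iInf]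
    exact ⟨hy m hm, fun j hj => hpos j hj m hm⟩
  rw [← hyz]
  refine map_supportedSubalgebra_le (φ := laurentEval xUnit) (fun m hm => ?_) ⟨y, hy', rfl⟩
  simp only [AddSubmonoid.mem_inf, AddSubmonoid.mem_iInf] at hm
  rw [laurentEval_laurentMonomial]
  refine monomial_mem fun i => ?_
  by_cases hi : i ∈ σ.freeVariables
  · exact zpow_mem_of_nonneg (Algebra.subset_adjoin (Set.mem_image_of_mem x hi))
      (mem_nonnegAt.1 (hm.2 i hi))
  · rw [mem_zeroOn.1 hm.1 i hi, zpow_zero]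
    exact Subalgebra.one_mem _

/-- A free variable is polyamorous if its exchange polynomial specialises to zero. -/
theorem isPolyamorousVariable_of_exchange {Q : ClusterQuiver n} {σ : Specialisation n} {j : Fin n}
    (hj : j ∈ σ.freeVariables)
    (h : laurentEval σ.value (1 + laurentMonomial fun i => Q.exchangeMatrix i j) = 0) :
    IsPolyamorousVariable Q σ j := by
  refine ⟨hj, ?_⟩
  rintro _ ⟨z, hz, rfl⟩
  obtain ⟨y, hy, w, hw⟩ := exists_dvd_sub_of_mem_adjacentLaurent
    (skew_self Q.exchangeMatrix_skew j) (mem_adjacentLaurent hz j)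
  have hzy : laurentEval σ.value z = laurentEval σ.value y := by
    rw [← sub_eq_zero, ← map_sub, hw, map_mul, h, zero_mul]
  change laurentEval σ.value z ∈ _
  rw [hzy]
  refine map_supportedSubalgebra_le (φ := laurentEval σ.value) (fun m hm => ?_) ⟨y, hy, rfl⟩
  rw [laurentEval_laurentMonomial]
  refine monomial_mem fun i => ?_
  rcases hi : σ i with _ | a
  · rw [value_of_none hi]
    by_cases hij : i = j
    · subst hij
      exact zpow_mem_of_nonneg (Algebra.subset_adjoin (Or.inl rfl)) (mem_nonnegAt.1 hm)
    · rcases le_total 0 (m i) with hm | hm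
      · exact zpow_mem_of_nonneg (Algebra.subset_adjoin (Or.inr ⟨i, hi, hij, Or.inl rfl⟩)) hm
      · rw [← neg_neg (m i), zpow_neg, ← inv_zpow]
        refine zpow_mem_of_nonneg (Algebra.subset_adjoin (Or.inr ⟨i, hi, hij, Or.inr ?_⟩))
          (neg_nonneg.2 hm)
        exact Units.val_inv_eq_inv_val _
  · exact value_zpow_mem_of_some hi _ _

theorem exists_isPolyamorous {Q : ClusterQuiver n} {j k : Fin n}
    (h : Odd (Q.arrowsBetween j k)) :
    ∃ σ : Specialisation n, IsPolyamorous Q σ ∧ σ.freeVariables.Nonempty := by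
  have hjk : j ≠ k := by
    rintro rfl
    simp [ClusterQuiver.arrowsBetween, Q.no_loops] at h
  -- Only k contributes to the exchange monomial at j, namely (-1) raised to the odd number B k j.
  let σ : Specialisation n := fun i => if i = j then none else if i = k then some (-1) else some 1
  have hσ : ∀ i, i ∈ σ.freeVariables ↔ i = j := by
    intro i
    change (if i = j then none else if i = k then some (-1) else some (1 : ℤˣ)) = none ↔ i = j
    split_ifs <;> simp_all
  refine ⟨σ, fun i hi => ?_, j, (hσ j).2 rfl⟩
  obtain rfl := (hσ i).1 hi
  refine isPolyamorousVariable_of_exchange hi ?_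
  have hodd : Odd (Q.exchangeMatrix k i) := by
    obtain ⟨t, ht⟩ := h
    refine ⟨t - Q.arrows i k, ?_⟩
    simp only [ClusterQuiver.arrowsBetween] at ht
    simp only [ClusterQuiver.exchangeMatrix]
    omega
  have hmon : (monomial σ.value fun l => Q.exchangeMatrix l i) = -1 := by
    rw [monomial, Finset.prod_eq_single k]
    · have hk : σ k = some (-1) := by simp [σ, hjk.symm]
      have hv : σ.value k = -1 := by
        rw [value_of_some hk]
        ext
        simp
      rw [hv, hodd.neg_one_zpow]
    · intro l _ hl
      by_cases hli : l = i
      · rw [hli, skew_self Q.exchangeMatrix_skew, zpow_zero]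
      · have hl1 : σ l = some 1 := by simp [σ, hl, hli]
        rw [value_of_some hl1, map_one, one_zpow]
    · simp
  rw [map_add, map_one, laurentEval_laurentMonomial, hmon]
  simp

end Specialised

end Cluster

end

/-- The first conjunct of the conclusion says that specialisation is defined on all of `𝒜_Q`. -/
theorem mainTheorem2 {n : ℕ} (Q : Cluster.ClusterQuiver n)
    (hQ : ∃ j k : Fin n, Odd (Q.arrowsBetween j k)) :
    Cluster.clusterAlgebra Q ≤ Cluster.laurentSubalgebra n ∧
    (∃ σ : Cluster.Specialisation n, Cluster.IsPolyamorous Q σ ∧ σ.freeVariables.Nonempty) ∧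
    ∀ σ : Cluster.Specialisation n, Cluster.IsPolyamorous Q σ →
      Cluster.specialisedClusterAlgebra Q σ = Cluster.polynomialRing σ := by
  obtain ⟨j, k, hjk⟩ := hQ
  exact ⟨Cluster.clusterAlgebra_le_laurentSubalgebra Q j, Cluster.exists_isPolyamorous hjk,
    fun σ hσ => hσ.specialisedClusterAlgebra_eq⟩
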